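/- **Conventions.** For integers $a_1,\dots,a_n$ ($n\ge 1$) let $P(a_1,\dots,a_n)$ be the pretzel link diagram whose $i$-th column is a vertical twist of two strands with $|a_i|$ crossings, of sign type given by the sign of $a_i$. Let $\alpha,\beta,z$ be the numbers of entries equal to $1,-1,0$ respectively, $r$ the number of entries $>1$, $s$ the number of entries $<-1$, $\lambda=\alpha-\beta$, and $\Sigma=\sum_{|a_i|>1}|a_i|$. The diagram is *reduced* if it is $P(1,-1)$, or if $\alpha\beta=0$ and ($z\neq0$ implies $\alpha=\beta=0$). For an oriented link $L$ with oriented diagram $D$ of writhe $w(D)$, the Jones polynomial is $V(L)=(-A)^{-3w(D)}\langle D\rangle$ with $A=t^{-1/4}$, where $\langle\cdot\rangle$ is the Kauffman bracket normalized by $\langle\bigcirc\rangle=-A^{-2}-A^{2}$; so $V(\bigcirc)=-t^{-1/2}-t^{1/2}$. Its span is the difference between its highest and its lowest exponent of $t$. **Theorem.** Let $P(a_1,\dots,a_n)$ be a reduced pretzel diagram with $n\ge1$ and $a_1\ge\dots\ge a_n$, with $r,s,z,\lambda,\Sigma$ as above. Let $L$ be an oriented link having $P(c_1,\dots,c_n)$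 as a diagram (with any orientation), where $(c_1,\dots,c_n)$ is a rearrangement of $(a_1,\dots,a_n)$ or of $(-a_1,\dots,-a_n)$. Then $V(L)\ne0$, and its span $S$ is an integer given as follows. 1. If $z>0$: $S=\Sigma+z$. In the remaining cases $z=0$. 2. If $r+\lambda\ne1$ and $s-\lambda\neq1$: $S=\Sigma-\min\{1,r+\lambda,s-\lambda\}+1$, except for $P(1,-1)$, for which $S=2$. In the remaining cases $z=0$ and $r+\lambda=1$ (the case $s-\lambda=1$ reduces to this one by changing the sign of all entries). 3. Suppose $r>1$. - 3.1. If $(r,\lambda,s)\ne(2,-1,0)$: $S=\Sigma-1$. In 3.2–3.5, $(r,\lambda,s)=(2,-1,0)$. - 3.2. If $a_2=2$, $a_1=2$: $S=\Sigma-2=2$. - 3.3. If $a_2=2$, $a_1=3$: $S=\Sigma-4=1$. - 3.4. If $a_2=2$, $a_1>3$: $S=\Sigma-3=a_1-1$. - 3.5. If $a_2>2$: $S=\Sigma-2=a_1+a_2-2$. 4. Suppose $r=1$ and $s\le1$. - 4.1. If $s=0$: $S=1=\Sigma-a_1+1$. - 4.2. If $s=1$, $|a_1+a_2|=0$: $S=2$.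 - 4.3. If $s=1$, $|a_1+a_2|=1$: $S=1$. - 4.4. If $s=1$, $|a_1+a_2|>1$: $S=1+|a_1+a_2|$. 5. Suppose $r=1$ and $s>1$. - 5.1. If $a_1\ne|a_2|-1$: $S=\Sigma-\min\{a_1,|a_2|-1\}$. - 5.2. If $a_1=|a_2|-1$ and $|a_2|\ne|a_3|-1$: $S=\Sigma-\min\{|a_2|,|a_3|-1\}$. - 5.3. If $s=2$, $a_1=|a_2|-1$ and $|a_2|=|a_3|-1$: $S=2a_1$, except for $P(2,-3,-4)$, for which $S=3$. In 5.4–5.6, $s\ge3$, $a_1=|a_2|-1$ and $|a_2|=|a_3|-1$. - 5.4. If $|a_3|<|a_4|-1$: $S=\Sigma-a_1-3$, except for the diagrams $P(2,-3,-4,a_4,\dots,a_n)$ ($n\geq4$) with $a_4<-6$, for which $S=\Sigma-6$. - 5.5. If $|a_3|=|a_4|-1$: $S=\Sigma-a_1-2$. - 5.6. If $|a_3|=|a_4|$: $S=\Sigma-a_1-1$. 6. Suppose $r=0$ and it is not the case that $n\ge2$ and $a_2=-2$. - 6.1. If $s=0$: $S=\Sigma+1=1$. - 6.2. If $s=1$: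 $S=\Sigma=-a_2$. - 6.3. If $s=2$: $S=\Sigma-2$. - 6.4. If $s>2$: $S=\Sigma-1$. 7. Suppose $r=0$, $n\ge2$ and $a_2=-2$. - 7.1. If $s=1$: $S=\Sigma-1=1$. - 7.2. If $s=2$, $a_3=-2$: $S=\Sigma-2=2$. - 7.3. If $s=2$, $a_3=-3$: $S=\Sigma-4=1$. - 7.4. If $s=2$, $a_3<-3$: $S=\Sigma-3=-1-a_3$. - 7.5. If $s=3$, $a_3=-2$: $S=\Sigma-1=3-a_4$. - 7.6. If $s=3$, $a_3=-3$, $a_4=-3$: $S=\Sigma-2=6$. - 7.7. If $s=3$, $a_3=-3$, $a_4=-4$: $S=\Sigma-6=3$. - 7.8. If $s=3$, $a_3=-3$, $a_4<-4$: $S=\Sigma-3=2-a_4$. - 7.9. If $s=3$, $a_3<-3$: $S=\Sigma-2=-a_3-a_4$. - 7.10. If $s>3$, $a_3=-2$: $S=\Sigma-1$. - 7.11. If $s>3$, $a_3=-3$, $a_4=-3$: $S=\Sigma-2$. - 7.12. If $s>3$, $a_3=-3$, $a_4=-4$, $a_5=-4$: $S=\Sigma-3$. - 7.13. If $s>3$,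 $a_3=-3$, $a_4=-4$, $a_5=-5$: $S=\Sigma-4$. - 7.14. If $s>3$, $a_3=-3$, $a_4=-4$, $a_5<-5$: $S=\Sigma-5$, except for the diagrams $P(1,-2,-3,-4,a_5,\dots,a_n)$ ($n\geq5$) with $a_5<-6$, for which $S=\Sigma-6$. - 7.15. If $s>3$, $a_3=-3$, $a_4<-4$: $S=\Sigma-3$. - 7.16. If $s>3$, $a_3<-3$: $S=\Sigma-2$. -/

import Mathlib

open scoped LaurentPolynomial

/-! ### Link diagrams, Kauffman bracket, Jones polynomial -/

/-- The combinatorial data of an unoriented link diagram. Marked points are placed on the curves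
of the diagram, away from the crossings, so that they cut it into
* `Crossing`s: small discs containing one crossing, whose four corners, listed
  counterclockwise as `0, 1, 2, 3`, are marked points; the under-strand joins the corners `0` and
  `2`, the over-strand joins the corners `1` and `3`;
* `Arc`s: crossingless pieces of curve between two marked points
  (the end points are indexed by `Bool`).
At every marked point exactly two pieces meet. This is planar-diagram code, in which closed curves
without crossings are allowed. -/
structure LinkDiagram where
  Point : Type
  Arc : Type
  Crossing : Type
  [fintypePoint : Fintype Point]
  [fintypeArc : Fintype Arc]
  [fintypeCrossing : Fintype Crossing]
  [decEqCrossing : DecidableEq Crossing]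
  arcEnd : Arc → Bool → Point
  corner : Crossing → Fin 4 → Point
  two_ends : ∀ p : Point,
    Nat.card {e : (Arc × Bool) ⊕ (Crossing × Fin 4) //
      Sum.elim (fun x => arcEnd x.1 x.2) (fun x => corner x.1 x.2) e = p} = 2

attribute [instance] LinkDiagram.fintypePoint LinkDiagram.fintypeArc
  LinkDiagram.fintypeCrossing LinkDiagram.decEqCrossing

namespace LinkDiagram

/-- The ends of the pieces (arcs and crossings) of a diagram. -/
abbrev End (D : LinkDiagram) : Type := (D.Arc × Bool) ⊕ (D.Crossing × Fin 4)

/-- The marked point at which an end of a piece is located. -/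
def endPoint (D : LinkDiagram) : D.End → D.Point :=
  Sum.elim (fun x => D.arcEnd x.1 x.2) (fun x => D.corner x.1 x.2)

/-- A Kauffman state chooses at each crossing the `A`-smoothing (`true`) or the `B`-smoothing
(`false`). -/
abbrev State (D : LinkDiagram) : Type := D.Crossing → Bool

/-- Two marked points are joined, in the smoothed diagram, by an arc or by a branch of
the smoothing of a crossing. The `A`-smoothing merges the two regions swept by the over-strand
`1–3` when it is rotated counterclockwise, so its two branches join `0` with `1` and `2` with `3`;
the branches of the `B`-smoothing join `1` with `2` and `3` with `0`. -/
inductive Joined (D : LinkDiagram) (σ : D.State) : D.Point → D.Point → Prop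
  | arc (e : D.Arc) : Joined D σ (D.arcEnd e false) (D.arcEnd e true)
  | A₁ (c : D.Crossing) (h : σ c = true) : Joined D σ (D.corner c 0) (D.corner c 1)
  | A₂ (c : D.Crossing) (h : σ c = true) : Joined D σ (D.corner c 2) (D.corner c 3)
  | B₁ (c : D.Crossing) (h : σ c = false) : Joined D σ (D.corner c 1) (D.corner c 2)
  | B₂ (c : D.Crossing) (h : σ c = false) : Joined D σ (D.corner c 3) (D.corner c 0)

/-- The number of closed curves of the smoothed diagram: the number of classes of marked points
under the equivalence relation generated by `Joined`. -/
noncomputable def loops (D : LinkDiagram) (σ : D.State) : ℕ := Nat.card (Quot (D.Joined σ))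

/-- `δ = -A⁻² - A²`, in the ring of Laurent polynomials in the variable `A`. -/
noncomputable def delta : ℤ[T;T⁻¹] := -LaurentPolynomial.T (-2) - LaurentPolynomial.T 2

/-- The Kauffman bracket, by Kauffman's state sum, normalized so that the value of the
crossingless diagram of the unknot is `δ`. -/
noncomputable def bracket (D : LinkDiagram) : ℤ[T;T⁻¹] :=
  ∑ σ : D.State,
    LaurentPolynomial.T (∑ c : D.Crossing, if σ c then (1 : ℤ) else -1) * delta ^ D.loops σ

/-- An orientation of (all the components of) a link diagram. For an end `x` of an arc or
crossing, `into x = true` means that the oriented curve runs at `x` from the marked point into the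
piece, `into x = false` that it comes out of the piece. -/
structure Orientation (D : LinkDiagram) where
  into : D.End → Bool
  arc : ∀ e : D.Arc, into (.inl (e, false)) ≠ into (.inl (e, true))
  under_strand : ∀ c : D.Crossing, into (.inr (c, 0)) ≠ into (.inr (c, 2))
  over_strand : ∀ c : D.Crossing, into (.inr (c, 1)) ≠ into (.inr (c, 3))
  point : ∀ x y : D.End, x ≠ y → D.endPoint x = D.endPoint y → into x ≠ into y

/-- The writhe. If the under-strand enters a crossing at the corner `0`, the crossing is positive
when the over-strand enters it at `3`, and negative when the over-strand enters it at `1`;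
reversing both strands does not change the sign. -/
def writhe (D : LinkDiagram) (o : D.Orientation) : ℤ :=
  ∑ c : D.Crossing, if o.into (.inr (c, 0)) = o.into (.inr (c, 3)) then 1 else -1

/-- The variable `A` as a unit of the ring of Laurent polynomials. -/
noncomputable def unitA : (ℤ[T;T⁻¹])ˣ where
  val := LaurentPolynomial.T 1
  inv := LaurentPolynomial.T (-1)
  val_inv := by rw [← LaurentPolynomial.T_add]; simp
  inv_val := by rw [← LaurentPolynomial.T_add]; simp

/-- The Jones polynomial `V(L)` of the oriented link `L` presented by the diagram `D` with
orientation `o`, with value `-t^{-1/2} - t^{1/2}` on the unknot: `(-A)^{-3 w(D)} ⟨D⟩` after the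
substitution `A = t^{-1/4}`. It is written as a polynomial in rational powers of `t`. -/
noncomputable def jones (D : LinkDiagram) (o : D.Orientation) : AddMonoidAlgebra ℤ ℚ :=
  AddMonoidAlgebra.mapDomain (fun k : ℤ => -(k : ℚ) / 4)
    ((((-unitA) ^ (-3 * D.writhe o) : (ℤ[T;T⁻¹])ˣ) : ℤ[T;T⁻¹]) * D.bracket)

end LinkDiagram

/-- The span of a nonzero polynomial in rational powers of `t`: the difference between
the highest and the lowest exponent that occur in it (and `0` for the zero polynomial). -/
noncomputable def tSpan (f : AddMonoidAlgebra ℤ ℚ) : ℚ :=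
  if h : f.coeff.support.Nonempty then f.coeff.support.max' h - f.coeff.support.min' h else 0

/-! ### Pretzel diagrams -/

namespace Pretzel

variable {n : ℕ}

/-- Marked points of `P(a_1, …, a_n)`: column `i` is a vertical twist of two strands with
`|a_i|` crossings, which carries a left (`false`) and a right (`true`) marked point on each of the
levels `0, …, |a_i|`, from top to bottom. -/
abbrev Point (a : Fin n → ℤ) : Type := Σ i : Fin n, Fin ((a i).natAbs + 1) × Bool

/-- Crossings: the `k`-th crossing of column `i` lies between the levels `k` and `k + 1`. -/
abbrev Crossing (a : Fin n → ℤ) : Type := Σ i : Fin n, Fin (a i).natAbs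

/-- Arcs: at the top (`false`) and at the bottom (`true`), the right strand of column `i` is
joined to the left strand of the next column (cyclically). -/
def arcEnd [NeZero n] (a : Fin n → ℤ) : Fin n × Bool → Bool → Point a
  | (i, false), false => ⟨i, 0, true⟩
  | (i, false), true => ⟨i + 1, 0, false⟩
  | (i, true), false => ⟨i, Fin.last _, true⟩
  | (i, true), true => ⟨i + 1, Fin.last _, false⟩

/-- Corners of a crossing, counterclockwise. For a positive entry they start at the top left:
the over-strand joins bottom left to top right, so the `A`-smoothing is the vertical one.
For a negative entry they start at the bottom left: the over-strand joins
bottom right to top left, and the `A`-smoothing is the horizontal one. -/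
def corner (a : Fin n → ℤ) (c : Crossing a) (m : Fin 4) : Point a :=
  ![⟨c.1, c.2.castSucc, false⟩, ⟨c.1, c.2.succ, false⟩,
    ⟨c.1, c.2.succ, true⟩, ⟨c.1, c.2.castSucc, true⟩] (if 0 < a c.1 then m else m + 1)

theorem point_ext {a : Fin n → ℤ} {p q : Point a} :
    p = q ↔ p.1 = q.1 ∧ p.2.1.val = q.2.1.val ∧ p.2.2 = q.2.2 := by
  constructor
  · rintro rfl; simp
  · obtain ⟨i, k, b⟩ := p
    obtain ⟨j, l, d⟩ := q
    rintro ⟨h, h', h''⟩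
    dsimp only at h h' h''
    subst h h''
    rw [Fin.ext h']

/-- At every marked point, exactly one piece is attached from above and one from below. -/
theorem two_ends [NeZero n] (a : Fin n → ℤ) (p : Point a) :
    Nat.card {e : ((Fin n × Bool) × Bool) ⊕ (Crossing a × Fin 4) //
      Sum.elim (fun x => arcEnd a x.1 x.2) (fun x => corner a x.1 x.2) e = p} = 2 := by
  obtain ⟨i, ⟨k, hk⟩, b⟩ := p
  let U : ((Fin n × Bool) × Bool) ⊕ (Crossing a × Fin 4) :=
    if h : k = 0 then .inl (if b then ((i, false), false) else ((i - 1, false), true))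
    else .inr (⟨i, ⟨k - 1, by omega⟩⟩,
      if 0 < a i then (if b then 2 else 1) else (if b then 1 else 0))
  let V : ((Fin n × Bool) × Bool) ⊕ (Crossing a × Fin 4) :=
    if h : k = (a i).natAbs then .inl (if b then ((i, true), false) else ((i - 1, true), true))
    else .inr (⟨i, ⟨k, by omega⟩⟩,
      if 0 < a i then (if b then 3 else 0) else (if b then 2 else 3))
  have hUV : U ≠ V := by
    simp only [U, V]
    split_ifs <;> simp
  have key : ∀ e, Sum.elim (fun x => arcEnd a x.1 x.2) (fun x => corner a x.1 x.2) e =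
      (⟨i, ⟨k, hk⟩, b⟩ : Point a) ↔ e = U ∨ e = V := by
    rintro (⟨⟨j, t⟩, u⟩ | ⟨⟨j, l⟩, m⟩)
    · have h1 : j + 1 = i ↔ j = i - 1 := eq_sub_iff_add_eq.symm
      cases t <;> cases u <;> simp only [Sum.elim_inl, arcEnd, point_ext, U, V]
      all_goals split_ifs
      all_goals simp_all
      all_goals grind
    · by_cases hji : j = i
      · subst hji
        obtain ⟨l, hl⟩ := l
        rw [Sum.elim_inr, corner, point_ext]
        by_cases ha : 0 < a j
        · rw [if_pos ha]
          by_cases h0 : k = 0 <;> by_cases h1 : k = (a j).natAbs <;>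
            fin_cases m <;> cases b <;>
            simp [U, V, ha, h0, h1] <;>
            (try split_ifs) <;> (try simp) <;> omega
        · rw [if_neg ha]
          by_cases h0 : k = 0 <;> by_cases h1 : k = (a j).natAbs <;>
            fin_cases m <;> cases b <;>
            simp [U, V, ha, h0, h1] <;>
            (try split_ifs) <;> (try simp) <;> omega
      · simp only [Sum.elim_inr, corner, U, V]
        split_ifs <;> fin_cases m <;> simp [hji]
  have : {e | Sum.elim (fun x => arcEnd a x.1 x.2) (fun x => corner a x.1 x.2) e =
      (⟨i, ⟨k, hk⟩, b⟩ : Point a)} = {U, V} := by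
    ext e; simpa using key e
  rw [← Set.coe_ofPred, Nat.card_coe_set_eq]
  rw [this, Set.ncard_pair hUV]

/-- The pretzel link diagram `P(a_1, …, a_n)`, `n ≥ 1`. -/
def diagram [NeZero n] (a : Fin n → ℤ) : LinkDiagram where
  Point := Point a
  Arc := Fin n × Bool
  Crossing := Crossing a
  arcEnd := arcEnd a
  corner := corner a
  two_ends := two_ends a

/-- `r`: the number of entries `> 1`. -/
def r (a : Fin n → ℤ) : ℤ := (Finset.univ.filter fun i => 1 < a i).card
/-- `s`: the number of entries `< -1`. -/
def s (a : Fin n → ℤ) : ℤ := (Finset.univ.filter fun i => a i < -1).card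
/-- `z`: the number of entries `0`. -/
def z (a : Fin n → ℤ) : ℤ := (Finset.univ.filter fun i => a i = 0).card
/-- `α`: the number of entries `1`. -/
def alpha (a : Fin n → ℤ) : ℤ := (Finset.univ.filter fun i => a i = 1).card
/-- `β`: the number of entries `-1`. -/
def beta (a : Fin n → ℤ) : ℤ := (Finset.univ.filter fun i => a i = -1).card
/-- `λ = α - β`. -/
def lam (a : Fin n → ℤ) : ℤ := alpha a - beta a
/-- `Σ`: the sum of `|a_i|` over the entries with `|a_i| > 1`. -/
def sigma (a : Fin n → ℤ) : ℤ := ∑ i ∈ Finset.univ.filter (fun i => 1 < |a i|), |a i|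

/-- The `k`-th entry `a_k` of `(a_1, …, a_n)`, numbered from `1`
(with the dummy value `0` if there is no such entry). -/
def entry (a : Fin n → ℤ) (k : ℕ) : ℤ := if h : k - 1 < n then a ⟨k - 1, h⟩ else 0

/-- The tuple `a` is `(1, -1)`. -/
def IsOneNegOne (a : Fin n → ℤ) : Prop := n = 2 ∧ entry a 1 = 1 ∧ entry a 2 = -1

/-- Reduced pretzel diagrams. -/
def IsReduced (a : Fin n → ℤ) : Prop :=
  IsOneNegOne a ∨ (alpha a * beta a = 0 ∧ (z a ≠ 0 → alpha a = 0 ∧ beta a = 0))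

end Pretzel

/-! Put q = -A⁻⁴ = -t and φ = δ² - 1 = 1 - q - q⁻¹. In a smoothed pretzel diagram a closed curve
either lies inside a column, between two consecutive horizontal smoothings, or runs through the gaps
between columns. A column with h > 0 horizontal smoothings contributes h - 1 curves of the first
kind. The curves of the second kind are as many as the fully vertical columns, or 2 if there are
none (`loops_eq`). Hence the state sum factors over the columns (`state_term`,
`delta_pow_mul_bracket`): δⁿ⟨P(a)⟩ = A^(∑ aᵢ) · (∏ (q^aᵢ + φ) + φ ∏ (q^aᵢ - 1)). The right factor,
`pretzelPoly`, is symmetric in the entries, and negating all entries exchanges q and q⁻¹. Since δⁿ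
has span n in q, and the writhe factor is a unit monomial, S = -v - w - n, where v and w are the
lowest exponents of q for the tuple and for its negative (`jones_span_of_lowDeg`).

It remains to find v. If an entry is 0, the second product vanishes. Otherwise, with N the sum of
|aᵢ| over the entries below -1, the two summands start at the exponents -N - r - α and -N - 1 - β.
If these differ, v is the smaller one. If they agree, the lowest coefficients cancel; for α = 0 and
r > 1 the second coefficients do not, and v goes up by one (`lowDeg_cancel`).

The delicate case is a single positive entry a with all other entries -(c + 1), c ≥ 1. Up to a power
of q the polynomial is then `numer a B`, of the form X^w U · prodFst + W · (prodSnd - prodFst) with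
W(0) = 1. The difference prodSnd - prodFst is divisible by exactly X^m, m = min B, with lowest
coefficient the multiplicity of m. So w competes with m, and cancellation occurs only if w = m and
U(0) is minus that multiplicity. Then the entry m is moved into U and W, and the comparison is
repeated with the next one; at most three entries are removed (`valOf`, `hasVal_numer`).

For v and w to need a cancellation analysis at once, r + λ = s - λ = 1, so r + s = 2: this leaves
(r, λ, s) = (2, -1, 0), (1, 0, 1), (0, 1, 2). -/

namespace Pretzel

/-! ### The closed curves of a smoothed pretzel diagram -/

variable {n : ℕ}

/-- The state `σ` smooths the crossing `x` vertically. -/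
def IsVert (a : Fin n → ℤ) (σ : Crossing a → Bool) (x : Crossing a) : Prop :=
  σ x = true ↔ 0 < a x.1

/-- The relation generated on the top (`false`) and bottom (`true`) parts of the gaps between the
columns, when the columns in `K` are smoothed vertically and the others are not. -/
inductive GapRel [NeZero n] (K : Fin n → Prop) : Bool × Fin n → Bool × Fin n → Prop
  | left (i : Fin n) (h : K i) : GapRel K (false, i) (true, i)
  | right (i : Fin n) (h : K i) : GapRel K (false, i + 1) (true, i + 1)
  | across (i : Fin n) (h : ¬ K i) (s : Bool) : GapRel K (s, i) (s, i + 1)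

/-- All crossings of column `i` are smoothed vertically. -/
def VertColumn (a : Fin n → ℤ) (σ : Crossing a → Bool) (i : Fin n) : Prop :=
  ∀ k, IsVert a σ ⟨i, k⟩

/-- The horizontally smoothed crossings which have another one above them in their column. -/
def NonFirst (a : Fin n → ℤ) (σ : Crossing a → Bool) (x : Crossing a) : Prop :=
  ¬ IsVert a σ x ∧ ∃ j < x.2, ¬ IsVert a σ ⟨x.1, j⟩

/-- The numbering of the corners and the sign of the column are dealt with here, for invariants of
closed curves; afterwards only "vertical" and "horizontal" matter. -/
theorem joined_lift [NeZero n] {a : Fin n → ℤ} {σ : Crossing a → Bool} {Z : Type*}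
    (f : Point a → Z)
    (htop : ∀ i, f ⟨i, 0, true⟩ = f ⟨i + 1, 0, false⟩)
    (hbot : ∀ i, f ⟨i, Fin.last _, true⟩ = f ⟨i + 1, Fin.last _, false⟩)
    (hv : ∀ x, IsVert a σ x → ∀ s, f ⟨x.1, x.2.castSucc, s⟩ = f ⟨x.1, x.2.succ, s⟩)
    (hh₁ : ∀ x, ¬ IsVert a σ x → f ⟨x.1, x.2.castSucc, false⟩ = f ⟨x.1, x.2.castSucc, true⟩)
    (hh₂ : ∀ x, ¬ IsVert a σ x → f ⟨x.1, x.2.succ, false⟩ = f ⟨x.1, x.2.succ, true⟩)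
    {p q : (diagram a).Point} (h : (diagram a).Joined σ p q) : f p = f q := by
  cases h with
  | arc e => obtain ⟨i, _ | _⟩ := e <;> simp [diagram, arcEnd, htop, hbot]
  | A₁ x h =>
    by_cases hx : 0 < a x.1 <;> simp only [diagram, corner, hx, if_true, if_false]
    · exact hv x (by simp [IsVert, h, hx]) false
    · exact hh₂ x (by simp [IsVert, h, hx])
  | A₂ x h =>
    by_cases hx : 0 < a x.1 <;> simp only [diagram, corner, hx, if_true, if_false]
    · exact (hv x (by simp [IsVert, h, hx]) true).symm
    · exact (hh₁ x (by simp [IsVert, h, hx])).symm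
  | B₁ x h =>
    by_cases hx : 0 < a x.1 <;> simp only [diagram, corner, hx, if_true, if_false]
    · exact hh₂ x (by simp [IsVert, h, hx])
    · exact (hv x (by simp [IsVert, h, hx]) true).symm
  | B₂ x h =>
    by_cases hx : 0 < a x.1 <;> simp only [diagram, corner, hx, if_true, if_false]
    · exact (hh₁ x (by simp [IsVert, h, hx])).symm
    · exact hv x (by simp [IsVert, h, hx]) false

section Classes

variable [NeZero n] {a : Fin n → ℤ} {σ : Crossing a → Bool}

/-- The closed curve through a marked point. -/
def cls (a : Fin n → ℤ) (σ : Crossing a → Bool) (p : Point a) : Quot ((diagram a).Joined σ) :=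
  Quot.mk _ p

theorem cls_top (i : Fin n) : cls a σ ⟨i, 0, true⟩ = cls a σ ⟨i + 1, 0, false⟩ :=
  Quot.sound (LinkDiagram.Joined.arc (D := diagram a) (σ := σ) (i, false))

theorem cls_bot (i : Fin n) :
    cls a σ ⟨i, Fin.last _, true⟩ = cls a σ ⟨i + 1, Fin.last _, false⟩ :=
  Quot.sound (LinkDiagram.Joined.arc (D := diagram a) (σ := σ) (i, true))

theorem cls_vert (x : Crossing a) (hx : IsVert a σ x) (s : Bool) :
    cls a σ ⟨x.1, x.2.castSucc, s⟩ = cls a σ ⟨x.1, x.2.succ, s⟩ := by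
  have A₁ := fun h => Quot.sound (LinkDiagram.Joined.A₁ (D := diagram a) (σ := σ) x h)
  have A₂ := fun h => Quot.sound (LinkDiagram.Joined.A₂ (D := diagram a) (σ := σ) x h)
  have B₁ := fun h => Quot.sound (LinkDiagram.Joined.B₁ (D := diagram a) (σ := σ) x h)
  have B₂ := fun h => Quot.sound (LinkDiagram.Joined.B₂ (D := diagram a) (σ := σ) x h)
  by_cases hp : 0 < a x.1 <;>
    simp only [diagram, corner, hp, if_true, if_false] at A₁ A₂ B₁ B₂ <;>
    simp only [IsVert, hp, iff_true, iff_false, Bool.not_eq_true] at hx <;> cases s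
  · exact A₁ hx
  · exact (A₂ hx).symm
  · exact B₂ hx
  · exact (B₁ hx).symm

theorem cls_horiz (x : Crossing a) (hx : ¬ IsVert a σ x) :
    cls a σ ⟨x.1, x.2.castSucc, false⟩ = cls a σ ⟨x.1, x.2.castSucc, true⟩ ∧
    cls a σ ⟨x.1, x.2.succ, false⟩ = cls a σ ⟨x.1, x.2.succ, true⟩ := by
  have A₁ := fun h => Quot.sound (LinkDiagram.Joined.A₁ (D := diagram a) (σ := σ) x h)
  have A₂ := fun h => Quot.sound (LinkDiagram.Joined.A₂ (D := diagram a) (σ := σ) x h)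
  have B₁ := fun h => Quot.sound (LinkDiagram.Joined.B₁ (D := diagram a) (σ := σ) x h)
  have B₂ := fun h => Quot.sound (LinkDiagram.Joined.B₂ (D := diagram a) (σ := σ) x h)
  by_cases hp : 0 < a x.1 <;>
    simp only [diagram, corner, hp, if_true, if_false] at A₁ A₂ B₁ B₂ <;>
    simp only [IsVert, hp, iff_true, iff_false, Bool.not_eq_true, Bool.not_eq_false] at hx
  · exact ⟨(B₂ hx).symm, B₁ hx⟩
  · exact ⟨(A₂ hx).symm, A₁ hx⟩

/-- A column passes straight through a block of levels without horizontal smoothings. -/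
theorem cls_block (i : Fin n) (s : Bool) (l m : ℕ) (hlm : l ≤ m) (hm : m < (a i).natAbs + 1)
    (h : ∀ k : Fin (a i).natAbs, l ≤ k → k.val < m → IsVert a σ ⟨i, k⟩) :
    cls a σ ⟨i, ⟨l, by omega⟩, s⟩ = cls a σ ⟨i, ⟨m, hm⟩, s⟩ := by
  induction m, hlm using Nat.le_induction with
  | base => rfl
  | succ m hlm ih =>
    rw [ih (by omega) fun k h1 h2 => h k h1 (by omega)]
    exact cls_vert ⟨i, ⟨m, by omega⟩⟩ (h _ hlm (by simp)) s

/-- `k` is the first horizontally smoothed crossing of column `i` below level `l`. -/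
def IsNext (a : Fin n → ℤ) (σ : Crossing a → Bool) (i : Fin n) (l : ℕ)
    (k : Fin (a i).natAbs) : Prop :=
  l ≤ k ∧ ¬ IsVert a σ ⟨i, k⟩ ∧ ∀ j : Fin (a i).natAbs, l ≤ j → j < k → IsVert a σ ⟨i, j⟩

omit [NeZero n] in
theorem IsNext.unique {i : Fin n} {l : ℕ} {k k' : Fin (a i).natAbs}
    (h : IsNext a σ i l k) (h' : IsNext a σ i l k') : k = k' := by
  rcases lt_trichotomy k k' with hk | hk | hk
  · exact absurd (h'.2.2 k h.1 hk) h.2.1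
  · exact hk
  · exact absurd (h.2.2 k' h'.1 hk) h'.2.1

omit [NeZero n] in
theorem exists_isNext {i : Fin n} {l : ℕ}
    (h : ∃ k : Fin (a i).natAbs, l ≤ k ∧ ¬ IsVert a σ ⟨i, k⟩) : ∃ k, IsNext a σ i l k := by
  obtain ⟨k, hk, hmin⟩ := WellFounded.has_min (wellFounded_lt (α := Fin (a i).natAbs))
    {k | l ≤ k.val ∧ ¬ IsVert a σ ⟨i, k⟩} h
  exact ⟨k, hk.1, hk.2, fun j hj hjk => by_contra fun hc => hmin j ⟨hj, hc⟩ hjk⟩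

/-- The gap to the left (`false`) or right (`true`) of column `i`. -/
def side (i : Fin n) (s : Bool) : Fin n := if s then i + 1 else i

open Classical in
/-- The name of the closed curve through a marked point. -/
noncomputable def curveName (a : Fin n → ℤ) (σ : Crossing a → Bool) (p : Point a) :
    {x // NonFirst a σ x} ⊕ Quot (GapRel (VertColumn a σ)) :=
  -- A curve inside a column is named by the lower of its two bounding horizontal crossings. If the
  -- next horizontal crossing below is the first of its column, the curve comes from the top gaps,
  -- which such a column joins to each other, so the left one serves for both strands. If there is
  -- none, the strand runs down to the bottom gap on its own side.
  if h : ∃ k, IsNext a σ p.1 p.2.1 k then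
    if h' : NonFirst a σ ⟨p.1, h.choose⟩ then .inl ⟨_, h'⟩ else .inr (Quot.mk _ (false, p.1))
  else .inr (Quot.mk _ (true, side p.1 p.2.2))

theorem curveName_nonFirst {i : Fin n} {l} {s : Bool} {k}
    (h : IsNext a σ i l.val k) (h' : NonFirst a σ ⟨i, k⟩) :
    curveName a σ ⟨i, l, s⟩ = .inl ⟨_, h'⟩ := by
  have hex : ∃ k, IsNext a σ i l.val k := ⟨k, h⟩
  have hk : hex.choose = k := hex.choose_spec.unique h
  unfold curveName
  rw [dif_pos hex, dif_pos (by rw [hk]; exact h')]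
  simp only [hk]

theorem curveName_first {i : Fin n} {l} {s : Bool} {k}
    (h : IsNext a σ i l.val k) (h' : ¬ NonFirst a σ ⟨i, k⟩) :
    curveName a σ ⟨i, l, s⟩ = .inr (Quot.mk _ (false, i)) := by
  have hex : ∃ k, IsNext a σ i l.val k := ⟨k, h⟩
  have hk : hex.choose = k := hex.choose_spec.unique h
  unfold curveName
  rw [dif_pos hex, dif_neg (by rw [hk]; exact h')]

theorem curveName_none {i : Fin n} {l} {s : Bool}
    (h : ¬ ∃ k, IsNext a σ i l.val k) :
    curveName a σ ⟨i, l, s⟩ = .inr (Quot.mk _ (true, side i s)) := by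
  unfold curveName
  rw [dif_neg h]

theorem curveName_congr {i : Fin n} {l l'} {s s' : Bool}
    (h : ∀ k, IsNext a σ i l.val k ↔ IsNext a σ i l'.val k)
    (hs : s = s' ∨ ∃ k, IsNext a σ i l.val k) :
    curveName a σ ⟨i, l, s⟩ = curveName a σ ⟨i, l', s'⟩ := by
  by_cases hex : ∃ k, IsNext a σ i l.val k
  · obtain ⟨k, hk⟩ := hex
    by_cases h' : NonFirst a σ ⟨i, k⟩
    · rw [curveName_nonFirst hk h', curveName_nonFirst ((h k).1 hk) h']
    · rw [curveName_first hk h', curveName_first ((h k).1 hk) h']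
  · obtain rfl := hs.resolve_right hex
    rw [curveName_none hex, curveName_none (by simpa only [← h] using hex)]

theorem gap_across {K : Fin n → Prop} {i : Fin n} (h : ¬ K i) (t s : Bool) :
    (Quot.mk (GapRel K) (t, i)) = Quot.mk _ (t, side i s) := by
  cases s
  · rfl
  · exact Quot.sound (.across i h t)

theorem gap_side {K : Fin n → Prop} {i : Fin n} (h : K i) (s : Bool) :
    (Quot.mk (GapRel K) (false, side i s)) = Quot.mk _ (true, side i s) := by
  cases s
  · exact Quot.sound (.left i h)
  · exact Quot.sound (.right i h)

theorem curveName_top (i : Fin n) (s : Bool) :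
    curveName a σ ⟨i, 0, s⟩ = .inr (Quot.mk _ (false, side i s)) := by
  by_cases hex : ∃ k, IsNext a σ i (0 : Fin ((a i).natAbs + 1)).val k
  · obtain ⟨k, hk⟩ := hex
    rw [curveName_first hk, gap_across (fun hc => hk.2.1 (hc k))]
    rintro ⟨-, j, hj, hj'⟩
    exact hj' (hk.2.2 j (by simp) hj)
  · rw [curveName_none hex, gap_side]
    intro k
    by_contra hc
    exact hex (exists_isNext ⟨k, by simp, hc⟩)

theorem curveName_bot (i : Fin n) (s : Bool) :
    curveName a σ ⟨i, Fin.last _, s⟩ = .inr (Quot.mk _ (true, side i s)) := by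
  refine curveName_none ?_
  rintro ⟨k, hk, -⟩
  simp only [Fin.val_last] at hk
  omega

theorem curveName_eq_of_joined {p q : Point a} (h : (diagram a).Joined σ p q) :
    curveName a σ p = curveName a σ q := by
  refine joined_lift _ (fun i => ?_) (fun i => ?_) (fun x hx s => ?_) (fun x hx => ?_)
    (fun x hx => ?_) h
  · rw [curveName_top, curveName_top]; rfl
  · rw [curveName_bot, curveName_bot]; rfl
  · refine curveName_congr (fun k => ?_) (.inl rfl)
    simp only [IsNext, Fin.val_castSucc, Fin.val_succ]
    constructor
    · rintro ⟨h1, h2, h3⟩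
      refine ⟨?_, h2, fun j hj => h3 j (by omega)⟩
      rcases h1.eq_or_lt with h1 | h1
      · obtain ⟨i, l⟩ := x
        obtain rfl : l = k := Fin.ext h1
        exact absurd hx h2
      · exact h1
    · rintro ⟨h1, h2, h3⟩
      refine ⟨by omega, h2, fun j hj hjk => ?_⟩
      rcases hj.eq_or_lt with h1 | h1
      · rwa [← Fin.ext h1]
      · exact h3 j h1 hjk
  · exact curveName_congr (fun _ => Iff.rfl) (.inr (exists_isNext ⟨x.2, le_rfl, hx⟩))
  · by_cases hex : ∃ k, IsNext a σ x.1 x.2.succ.val k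
    · exact curveName_congr (fun _ => Iff.rfl) (.inr hex)
    · rw [curveName_none hex, curveName_none hex, ← gap_across (fun hc => hx (hc x.2)),
        ← gap_across (fun hc => hx (hc x.2))]

/-- The marked points at the ends of the gaps. -/
def gapPoint (a : Fin n → ℤ) (g : Bool × Fin n) : Point a :=
  ⟨g.2, if g.1 then Fin.last _ else 0, false⟩

theorem cls_gapPoint_side (i : Fin n) (t s : Bool) :
    cls a σ (gapPoint a (t, side i s)) = cls a σ ⟨i, if t then Fin.last _ else 0, s⟩ := by
  cases s
  · rfl
  · cases t
    · exact (cls_top i).symm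
    · exact (cls_bot i).symm

theorem cls_vertColumn {i : Fin n} (h : VertColumn a σ i) (s : Bool) :
    cls a σ ⟨i, 0, s⟩ = cls a σ ⟨i, Fin.last _, s⟩ :=
  cls_block i s 0 (a i).natAbs (by omega) (by omega) fun k _ _ => h k

theorem cls_not_vertColumn {i : Fin n} (h : ¬ VertColumn a σ i) (t : Bool) :
    cls a σ ⟨i, if t then Fin.last _ else 0, false⟩ =
      cls a σ ⟨i, if t then Fin.last _ else 0, true⟩ := by
  simp only [VertColumn, not_forall] at h
  cases t
  · obtain ⟨k, hk⟩ := exists_isNext (l := 0) (h.imp fun k hk => ⟨by simp, hk⟩)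
    have := fun s => cls_block (σ := σ) i s 0 k.val (by omega) (by omega)
      fun j h1 h2 => hk.2.2 j h1 h2
    exact (this false).trans ((cls_horiz ⟨i, k⟩ hk.2.1).1.trans (this true).symm)
  · obtain ⟨k, hk, hmax⟩ := WellFounded.has_min (wellFounded_gt (α := Fin (a i).natAbs))
      {k | ¬ IsVert a σ ⟨i, k⟩} h
    have := fun s => cls_block (σ := σ) i s (k.val + 1) (a i).natAbs (by omega) (by omega)
      fun j h1 h2 => by_contra fun hc => hmax j hc (Fin.lt_def.2 h1)
    exact (this false).symm.trans ((cls_horiz ⟨i, k⟩ hk).2.trans (this true))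

theorem cls_gapPoint_eq {g g' : Bool × Fin n} (h : GapRel (VertColumn a σ) g g') :
    cls a σ (gapPoint a g) = cls a σ (gapPoint a g') := by
  cases h with
  | left i h => exact cls_vertColumn h false
  | right i h =>
    rw [show i + 1 = side i true from rfl, cls_gapPoint_side, cls_gapPoint_side]
    exact cls_vertColumn h true
  | across i h s =>
    rw [show i + 1 = side i true from rfl, cls_gapPoint_side]
    exact cls_not_vertColumn h s

/-- The closed curves of a smoothed pretzel diagram: those inside the columns, and those which
run through the gaps. -/
noncomputable def curveEquiv (a : Fin n → ℤ) (σ : Crossing a → Bool) :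
    Quot ((diagram a).Joined σ) ≃ {x // NonFirst a σ x} ⊕ Quot (GapRel (VertColumn a σ)) where
  toFun := Quot.lift (curveName a σ) fun _ _ => curveName_eq_of_joined
  invFun := Sum.elim (fun x => cls a σ ⟨x.1.1, x.1.2.castSucc, false⟩)
    (Quot.lift (fun g => cls a σ (gapPoint a g)) fun _ _ => cls_gapPoint_eq)
  left_inv := by
    rintro ⟨i, ⟨l, hl⟩, s⟩
    change Sum.elim _ _ (curveName a σ _) = cls a σ _
    by_cases hex : ∃ k, IsNext a σ i l k
    · obtain ⟨k, hk⟩ := hex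
      have hb := cls_block (σ := σ) i s l k.val hk.1 (by omega) fun j h1 h2 => hk.2.2 j h1 h2
      have hs : cls a σ ⟨i, k.castSucc, false⟩ = cls a σ ⟨i, k.castSucc, s⟩ := by
        cases s
        · rfl
        · exact (cls_horiz ⟨i, k⟩ hk.2.1).1
      by_cases h' : NonFirst a σ ⟨i, k⟩
      · rw [curveName_nonFirst (l := ⟨l, hl⟩) hk h']
        exact hs.trans hb.symm
      · rw [curveName_first (l := ⟨l, hl⟩) hk h']
        have := cls_block (σ := σ) i false 0 k.val (by omega) (by omega) fun j h1 h2 =>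
          by_contra fun hc => h' ⟨hk.2.1, j, h2, hc⟩
        exact this.trans (hs.trans hb.symm)
    · rw [curveName_none (l := ⟨l, hl⟩) hex]
      refine (cls_gapPoint_side i true s).trans ?_
      refine (cls_block i s l (a i).natAbs (by omega) (by omega) fun k h1 h2 => ?_).symm
      by_contra hc
      exact hex (exists_isNext ⟨k, h1, hc⟩)
  right_inv := by
    rintro (⟨⟨i, k⟩, hx⟩ | ⟨t, i⟩)
    · exact curveName_nonFirst (l := k.castSucc)
        ⟨le_rfl, hx.1, fun j h1 h2 => absurd h1 (not_le.2 h2)⟩ hx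
    · cases t
      · exact curveName_top i false
      · exact curveName_bot i false

theorem loops_eq (a : Fin n → ℤ) (σ : Crossing a → Bool) :
    (diagram a).loops σ =
      Nat.card {x // NonFirst a σ x} + Nat.card (Quot (GapRel (VertColumn a σ))) := by
  exact (Nat.card_congr (curveEquiv a σ)).trans Nat.card_sum

end Classes

end Pretzel

/-! ### Counting the closed curves -/

namespace Pretzel

variable {n : ℕ}

section GapCount

variable [NeZero n]

theorem val_iterate_add_one (i : Fin n) (m : ℕ) :
    ((· + 1)^[m] i).val = (i.val + m) % n := by
  induction m with
  | zero => simp [Nat.mod_eq_of_lt i.isLt]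
  | succ m ih =>
    rw [Function.iterate_succ_apply', Fin.val_add, ih, Fin.val_one', ← Nat.add_mod, add_assoc]

theorem exists_iterate_add_one (i k : Fin n) : ∃ m, (· + 1)^[m] i = k := by
  -- Run on to the column `0`, then take `k` more steps.
  refine ⟨n - i.val + k.val, Fin.ext ?_⟩
  rw [val_iterate_add_one, show i.val + (n - i.val + k.val) = k.val + n by omega,
    Nat.add_mod_right, Nat.mod_eq_of_lt k.isLt]

variable {K : Fin n → Prop}

theorem gap_iterate (t : Bool) (i : Fin n) (m : ℕ) (h : ∀ l < m, ¬ K ((· + 1)^[l] i)) :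
    (Quot.mk (GapRel K) (t, i)) = Quot.mk _ (t, (· + 1)^[m] i) := by
  induction m with
  | zero => rfl
  | succ m ih =>
    rw [ih fun l hl => h l (by omega), Function.iterate_succ_apply']
    exact Quot.sound (.across _ (h m (by omega)) t)

/-- All top parts form one circle around the diagram, all bottom parts another. -/
theorem card_gaps_of_none (h : ∀ i, ¬ K i) : Nat.card (Quot (GapRel K)) = 2 := by
  have e : Quot (GapRel K) ≃ Bool :=
    { toFun := Quot.lift Prod.fst fun _ _ hr => by
        cases hr with
        | left i hi => exact absurd hi (h i)
        | right i hi => exact absurd hi (h i)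
        | across i _ s => rfl
      invFun := fun t => Quot.mk _ (t, 0)
      left_inv := by
        rintro ⟨t, i⟩
        obtain ⟨m, rfl⟩ := exists_iterate_add_one 0 i
        exact gap_iterate t 0 m fun l _ => h _
      right_inv := fun t => rfl }
  rw [Nat.card_congr e]
  simp

open Classical in
-- The vertical columns cut the cycle of gaps into blocks. A block is one curve, its top and bottom
-- being joined along the vertical columns at its ends, and it is represented by the vertical column
-- on its right.
theorem card_gaps_of_exists (h : ∃ i, K i) : Nat.card (Quot (GapRel K)) = Nat.card {i // K i} := by
  have hex : ∀ i, ∃ m, K ((· + 1)^[m] i) := fun i => by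
    obtain ⟨k, hk⟩ := h
    obtain ⟨m, rfl⟩ := exists_iterate_add_one i k
    exact ⟨m, hk⟩
  let next : Fin n → {i // K i} := fun i => ⟨_, Nat.find_spec (hex i)⟩
  have hnext : ∀ i, ¬ K i → next (i + 1) = next i := by
    intro i hi
    apply Subtype.ext
    have := Nat.find_comp_succ (hex i) (hex (i + 1)) (by simpa using hi)
    simp only [next]
    rw [this, Function.iterate_succ_apply]
    rfl
  let f : Quot (GapRel K) → {i // K i} := Quot.lift (fun g => next g.2) fun _ _ hr => by
    cases hr with
    | left i hi => rfl
    | right i hi => rfl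
    | across i hi s => exact (hnext i hi).symm
  refine Nat.card_congr ⟨f, fun k => Quot.mk _ (true, k), ?_, ?_⟩
  · rintro ⟨t, i⟩
    have h1 : (Quot.mk (GapRel K) (t, i)) = Quot.mk _ (t, (next i).1) :=
      gap_iterate t i _ fun l hl => Nat.find_min (hex i) hl
    refine Eq.trans ?_ h1.symm
    cases t
    · exact (Quot.sound (.left _ (next i).2)).symm
    · rfl
  · rintro ⟨k, hk⟩
    apply Subtype.ext
    have : Nat.find (hex k) = 0 := (Nat.find_eq_zero _).2 hk
    change (· + 1)^[Nat.find (hex k)] k = k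
    rw [this]
    rfl

end GapCount

open Classical in
-- Only the minimum of a nonempty set has no predecessor in it. For the empty set the truncated
-- subtraction gives the correct value `0`.
theorem card_nonFirst_fin {N : ℕ} (p : Fin N → Prop) :
    Nat.card {k // p k ∧ ∃ j < k, p j} = (Finset.univ.filter p).card - 1 := by
  rw [Nat.card_eq_fintype_card, Fintype.card_subtype]
  by_cases h : (Finset.univ.filter p).Nonempty
  · rw [← Finset.card_erase_of_mem (Finset.min'_mem _ h)]
    congr 1
    ext k
    simp only [Finset.mem_filter, Finset.mem_univ, true_and, Finset.mem_erase]
    constructor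
    · rintro ⟨hk, j, hj, hpj⟩
      refine ⟨fun hc => ?_, hk⟩
      have := Finset.min'_le (Finset.univ.filter p) j (by simpa using hpj)
      rw [← hc] at this
      exact absurd hj (not_lt.2 this)
    · rintro ⟨hne, hk⟩
      refine ⟨hk, _, lt_of_le_of_ne (Finset.min'_le _ k (by simpa using hk)) (Ne.symm hne), ?_⟩
      simpa using Finset.min'_mem _ h
  · rw [Finset.not_nonempty_iff_eq_empty] at h
    rw [h, Finset.filter_eq_empty_iff.2]
    · rfl
    · intro k hk hc
      exact Finset.filter_eq_empty_iff.1 h hk hc.1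

open Classical in
/-- The number of horizontally smoothed crossings of column `i`. -/
noncomputable def horizCount (a : Fin n → ℤ) (σ : Crossing a → Bool) (i : Fin n) : ℕ :=
  (Finset.univ.filter fun k => ¬ IsVert a σ ⟨i, k⟩).card

theorem horizCount_eq_zero {a : Fin n → ℤ} {σ : Crossing a → Bool} {i : Fin n} :
    horizCount a σ i = 0 ↔ VertColumn a σ i := by
  simp [horizCount, VertColumn, Finset.filter_eq_empty_iff]

theorem card_nonFirst (a : Fin n → ℤ) (σ : Crossing a → Bool) :
    Nat.card {x // NonFirst a σ x} = ∑ i, (horizCount a σ i - 1) := by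
  let e : {x // NonFirst a σ x} ≃ Σ i, {k // NonFirst a σ ⟨i, k⟩} :=
    ⟨fun x => ⟨x.1.1, x.1.2, x.2⟩, fun y => ⟨⟨y.1, y.2.1⟩, y.2.2⟩, fun _ => rfl, fun _ => rfl⟩
  rw [Nat.card_congr e, Nat.card_sigma]
  refine Finset.sum_congr rfl fun i _ => ?_
  convert card_nonFirst_fin fun k => ¬ IsVert a σ ⟨i, k⟩
  · exact Iff.rfl
  · unfold horizCount
    congr

/-! ### The state sum as a product over the columns -/

open LaurentPolynomial LinkDiagram

theorem T_sum {ι : Type*} (s : Finset ι) (f : ι → ℤ) :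
    (T (∑ i ∈ s, f i) : ℤ[T;T⁻¹]) = ∏ i ∈ s, T (f i) := by
  classical
  induction s using Finset.induction_on with
  | empty => simp
  | insert i s hi ih => rw [Finset.sum_insert hi, Finset.prod_insert hi, T_add, ih]

/-- The exponent of `A` contributed by a smoothing. -/
def smoothingSign (b : Bool) : ℤ := if b then 1 else -1

/-- The weight of a smoothing, with a factor `δ` if it is horizontal. -/
noncomputable def weight (pos b : Bool) : ℤ[T;T⁻¹] :=
  T (smoothingSign b) * if b = pos then 1 else delta

/-- The weight of a smoothing, if it is vertical. -/
noncomputable def vertWeight (pos b : Bool) : ℤ[T;T⁻¹] :=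
  if b = pos then T (smoothingSign b) else 0

/-- The variable `q = -A⁻⁴` as a unit. -/
noncomputable def unitQ : (ℤ[T;T⁻¹])ˣ := -unitA ^ (-4 : ℤ)

theorem unitA_zpow (k : ℤ) : ((unitA ^ k : (ℤ[T;T⁻¹])ˣ) : ℤ[T;T⁻¹]) = T k := by
  induction k using Int.induction_on with
  | zero => simp
  | succ k ih => rw [zpow_add_one, Units.val_mul, ih, T_add]; rfl
  | pred k ih => rw [zpow_sub_one, Units.val_mul, ih, sub_eq_add_neg, T_add]; rfl

theorem delta_sq_sub_one :
    delta ^ 2 - 1 = 1 - (unitQ : ℤ[T;T⁻¹]) - (unitQ⁻¹ : (ℤ[T;T⁻¹])ˣ) := by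
  rw [unitQ, inv_neg, ← zpow_neg, Units.val_neg, Units.val_neg, unitA_zpow, unitA_zpow, delta,
    sub_sq, neg_sq, T_pow, T_pow, mul_assoc, neg_mul, ← T_add]
  norm_num
  ring

theorem sum_prod_eq_pow (N : ℕ) (f : Bool → ℤ[T;T⁻¹]) :
    ∑ τ : Fin N → Bool, ∏ k, f (τ k) = (f true + f false) ^ N := by
  have := Finset.prod_univ_sum (fun _ : Fin N => (Finset.univ : Finset Bool)) fun _ b => f b
  rw [Fintype.piFinset_univ] at this
  rw [← this]
  simp

theorem sum_vertWeight (m : ℤ) :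
    ∑ τ : Fin m.natAbs → Bool, ∏ k, vertWeight (decide (0 < m)) (τ k) = T m := by
  rw [sum_prod_eq_pow]
  by_cases h : 0 < m
  · simp only [vertWeight, h, decide_true, if_true, smoothingSign]
    rw [if_neg (by decide), add_zero, T_pow]
    congr 1
    omega
  · simp only [vertWeight, h, decide_false, if_true, smoothingSign]
    rw [if_neg (by decide), zero_add, T_pow, if_neg (by decide)]
    congr 1
    omega

/-- The column sum is the `m`-th power of the curl factor: A + A⁻¹δ = -A⁻³ for a positive crossing
and its inverse for a negative one, while Aq = -A⁻³. -/
theorem sum_weight (m : ℤ) :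
    ∑ τ : Fin m.natAbs → Bool, ∏ k, weight (decide (0 < m)) (τ k) =
      T m * ((unitQ ^ m : (ℤ[T;T⁻¹])ˣ) : ℤ[T;T⁻¹]) := by
  have key : ∀ e : ℤ, ((-unitA ^ e : (ℤ[T;T⁻¹])ˣ) : ℤ[T;T⁻¹]) = - T e := fun e => by
    rw [Units.val_neg, unitA_zpow]
  have hq : (unitA ^ m * unitQ ^ m : (ℤ[T;T⁻¹])ˣ) = (-unitA ^ (-3 : ℤ)) ^ m := by
    rw [← mul_zpow, unitQ]
    congr 1
    rw [mul_neg, ← zpow_one_add]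
    norm_num
  rw [sum_prod_eq_pow, ← unitA_zpow m, ← Units.val_mul, hq]
  by_cases h : 0 < m
  · have hm : m = (m.natAbs : ℤ) := by omega
    have h1 : weight (decide (0 < m)) true + weight (decide (0 < m)) false =
        ((-unitA ^ (-3 : ℤ) : (ℤ[T;T⁻¹])ˣ) : ℤ[T;T⁻¹]) := by
      rw [key]
      simp only [weight, h, decide_true, if_true, smoothingSign, mul_one]
      rw [if_neg (by decide), if_neg (by decide), delta, mul_sub, mul_neg, ← T_add, ← T_add]
      norm_num
    rw [h1]
    conv_rhs => rw [hm, zpow_natCast]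
    rw [Units.val_pow_eq_pow_val]
  · have hm : m = -(m.natAbs : ℤ) := by omega
    have h1 : weight (decide (0 < m)) true + weight (decide (0 < m)) false =
        (((-unitA ^ (-3 : ℤ))⁻¹ : (ℤ[T;T⁻¹])ˣ) : ℤ[T;T⁻¹]) := by
      rw [inv_neg, ← zpow_neg, key]
      simp only [weight, h, decide_false, if_true, smoothingSign, mul_one]
      rw [if_neg (by decide), if_neg (by decide), delta, mul_sub, mul_neg, ← T_add, ← T_add]
      norm_num
      ring
    rw [h1]
    conv_rhs => rw [hm, zpow_neg, zpow_natCast, ← inv_pow]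
    rw [Units.val_pow_eq_pow_val]

/-- `∏ (q ^ a_i + φ) + φ ∏ (q ^ a_i - 1)`, where `φ = 1 - q - q⁻¹`. -/
def pretzelPoly {R : Type*} [CommRing R] (q : Rˣ) (L : List ℤ) : R :=
  (L.map fun x => ((q ^ x : Rˣ) : R) + (1 - q - (q⁻¹ : Rˣ))).prod +
    (1 - q - (q⁻¹ : Rˣ)) * (L.map fun x => ((q ^ x : Rˣ) : R) - 1).prod

section StateSum

variable (a : Fin n → ℤ) (σ : Crossing a → Bool) (i : Fin n)

theorem prod_weight :
    ∏ k, weight (decide (0 < a i)) (σ ⟨i, k⟩) =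
      (∏ k, T (smoothingSign (σ ⟨i, k⟩))) * delta ^ horizCount a σ i := by
  classical
  simp only [weight, Finset.prod_mul_distrib, horizCount]
  rw [Finset.prod_ite, Finset.prod_const_one, one_mul, Finset.prod_const]
  congr 3
  ext k
  by_cases h : 0 < a i <;> simp [IsVert, h]

open Classical in
theorem prod_vertWeight :
    ∏ k, vertWeight (decide (0 < a i)) (σ ⟨i, k⟩) =
      if VertColumn a σ i then ∏ k, T (smoothingSign (σ ⟨i, k⟩)) else 0 := by
  split_ifs with hv
  · refine Finset.prod_congr rfl fun k _ => if_pos ?_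
    have := hv k
    by_cases h : 0 < a i <;> simpa [IsVert, h] using this
  · simp only [VertColumn, not_forall] at hv
    obtain ⟨k, hk⟩ := hv
    refine Finset.prod_eq_zero (Finset.mem_univ k) (if_neg ?_)
    by_cases h : 0 < a i <;> simpa [IsVert, h] using hk

/-- Let column `i` have `h` horizontal crossings. If some column is vertical, its factor in the
second product is zero. In the first product a vertical column carries δ² (its factor from δⁿ and
its gap curve), any other one δ · δ^(h - 1). If no column is vertical, both products are equal, and
their coefficients 1 and δ² - 1 add up to the δ² of the two gap curves. -/
theorem state_term [NeZero n] :
    delta ^ n * (T (∑ x, if σ x then (1 : ℤ) else -1) * delta ^ (diagram a).loops σ) =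
      ∏ i, (∏ k, weight (decide (0 < a i)) (σ ⟨i, k⟩) +
        (delta ^ 2 - 1) * ∏ k, vertWeight (decide (0 < a i)) (σ ⟨i, k⟩)) +
      (delta ^ 2 - 1) * ∏ i, (∏ k, weight (decide (0 < a i)) (σ ⟨i, k⟩) -
        ∏ k, vertWeight (decide (0 < a i)) (σ ⟨i, k⟩)) := by
  classical
  have hT : (T (∑ x, if σ x then (1 : ℤ) else -1) : ℤ[T;T⁻¹]) =
      ∏ i, ∏ k, T (smoothingSign (σ ⟨i, k⟩)) := by
    rw [T_sum, Fintype.prod_sigma]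
    rfl
  have hd : (delta ^ n : ℤ[T;T⁻¹]) = ∏ _i : Fin n, delta := by simp
  rw [hT, loops_eq, card_nonFirst, pow_add, ← Finset.prod_pow_eq_pow_sum]
  simp only [prod_weight, prod_vertWeight]
  by_cases hK : ∃ i, VertColumn a σ i
  · have h0 : ∏ i, ((∏ k, T (smoothingSign (σ ⟨i, k⟩))) * delta ^ horizCount a σ i -
        if VertColumn a σ i then ∏ k, T (smoothingSign (σ ⟨i, k⟩)) else 0) = 0 := by
      obtain ⟨i, hi⟩ := hK
      refine Finset.prod_eq_zero (Finset.mem_univ i) ?_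
      rw [if_pos hi, horizCount_eq_zero.2 hi]
      simp
    have hc : (delta ^ Nat.card {i // VertColumn a σ i} : ℤ[T;T⁻¹]) =
        ∏ i, if VertColumn a σ i then delta else 1 := by
      rw [Finset.prod_ite, Finset.prod_const_one, mul_one, Finset.prod_const,
        Nat.card_eq_fintype_card, Fintype.card_subtype]
    rw [h0, mul_zero, add_zero, card_gaps_of_exists hK, hc, hd, ← Finset.prod_mul_distrib,
      ← Finset.prod_mul_distrib, ← Finset.prod_mul_distrib]
    refine Finset.prod_congr rfl fun i _ => ?_
    split_ifs with hi
    · rw [horizCount_eq_zero.2 hi]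
      simp
      ring
    · obtain ⟨m, hm⟩ := Nat.exists_eq_succ_of_ne_zero (mt horizCount_eq_zero.1 hi)
      rw [hm]
      simp [pow_succ]
      ring
  · push Not at hK
    rw [card_gaps_of_none hK]
    simp only [hK, if_false, mul_zero, add_zero, sub_zero]
    have : ∏ i, ((∏ k, T (smoothingSign (σ ⟨i, k⟩))) * delta ^ horizCount a σ i) =
        delta ^ n * ((∏ i, ∏ k, T (smoothingSign (σ ⟨i, k⟩))) *
          ∏ i, delta ^ (horizCount a σ i - 1)) := by
      rw [hd, ← Finset.prod_mul_distrib, ← Finset.prod_mul_distrib]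
      refine Finset.prod_congr rfl fun i _ => ?_
      obtain ⟨m, hm⟩ := Nat.exists_eq_succ_of_ne_zero (mt horizCount_eq_zero.1 (hK i))
      rw [hm]
      simp [pow_succ]
      ring
    rw [this]
    ring

theorem delta_pow_mul_bracket [NeZero n] :
    delta ^ n * (diagram a).bracket =
      T (∑ i, a i) * pretzelPoly unitQ (List.ofFn a) := by
  -- A state is an independent choice of a state in each column, so sums of products over columns
  -- become products of sums.
  have hsplit : ∀ f : ∀ i, (Fin (a i).natAbs → Bool) → ℤ[T;T⁻¹],
      ∑ σ : Crossing a → Bool, ∏ i, f i (fun k => σ ⟨i, k⟩) = ∏ i, ∑ τ, f i τ := by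
    intro f
    have := Finset.prod_univ_sum (fun i => (Finset.univ : Finset (Fin (a i).natAbs → Bool))) f
    rw [Fintype.piFinset_univ] at this
    rw [this]
    exact (Equiv.piCurry fun (i : Fin n) (_ : Fin (a i).natAbs) => Bool).sum_comp
      fun p => ∏ i, f i (p i)
  have h1 : delta ^ n * (diagram a).bracket = ∑ σ : Crossing a → Bool,
      delta ^ n * (T (∑ x, if σ x then (1 : ℤ) else -1) * delta ^ (diagram a).loops σ) :=
    Finset.mul_sum _ _ _
  rw [h1, Finset.sum_congr rfl fun σ _ => state_term a σ, Finset.sum_add_distrib,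
    ← Finset.mul_sum,
    hsplit fun i τ => ∏ k, weight (decide (0 < a i)) (τ k) +
      (delta ^ 2 - 1) * ∏ k, vertWeight (decide (0 < a i)) (τ k),
    hsplit fun i τ => ∏ k, weight (decide (0 < a i)) (τ k) -
      ∏ k, vertWeight (decide (0 < a i)) (τ k)]
  simp only [Finset.sum_add_distrib, Finset.sum_sub_distrib, ← Finset.mul_sum, sum_weight,
    sum_vertWeight, delta_sq_sub_one, pretzelPoly, List.map_ofFn, List.prod_ofFn, T_sum,
    mul_add, Function.comp_apply]
  rw [← Finset.prod_mul_distrib, mul_left_comm, ← Finset.prod_mul_distrib]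
  congr 1
  · refine Finset.prod_congr rfl fun i _ => ?_
    ring
  · congr 1
    refine Finset.prod_congr rfl fun i _ => ?_
    ring

end StateSum

end Pretzel

/-! ### Lowest terms with respect to a unit -/

namespace Pretzel

open Polynomial

section Jets

variable {R : Type*} [CommRing R]

/-- `f = q ^ v * (c + d q + …)`, where the dots stand for a polynomial in `q`. -/
def HasJet (q : Rˣ) (f : R) (v c d : ℤ) : Prop :=
  ∃ g : ℤ[X], g.coeff 0 = c ∧ g.coeff 1 = d ∧ f = (q ^ v : Rˣ) * aeval (q : R) g

/-- `f = q ^ v * (c + …)`, where `c ≠ 0` and the dots stand for a polynomial in `q` without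
constant term. -/
def HasOrder (q : Rˣ) (f : R) (v : ℤ) : Prop := ∃ c d, c ≠ 0 ∧ HasJet q f v c d

variable {q : Rˣ} {f f' : R} {v v' c c' d d' : ℤ}

theorem HasJet.mul (h : HasJet q f v c d) (h' : HasJet q f' v' c' d') :
    HasJet q (f * f') (v + v') (c * c') (c * d' + d * c') := by
  obtain ⟨g, rfl, rfl, rfl⟩ := h
  obtain ⟨g', rfl, rfl, rfl⟩ := h'
  refine ⟨g * g', by simp [mul_coeff_zero], by rw [mul_coeff_one], ?_⟩
  rw [map_mul, zpow_add, Units.val_mul]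
  ring

theorem HasJet.add (h : HasJet q f v c d) (h' : HasJet q f' v c' d') :
    HasJet q (f + f') v (c + c') (d + d') := by
  obtain ⟨g, rfl, rfl, rfl⟩ := h
  obtain ⟨g', rfl, rfl, rfl⟩ := h'
  refine ⟨g + g', by simp, by simp, ?_⟩
  rw [map_add]
  ring

theorem HasJet.lower (h : HasJet q f v c d) (w : ℤ) (hw : w < v) : ∃ d', HasJet q f w 0 d' := by
  obtain ⟨g, rfl, rfl, rfl⟩ := h
  obtain ⟨m, rfl⟩ : ∃ m : ℕ, v = w + (m + 1 : ℕ) := ⟨(v - w - 1).toNat, by omega⟩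
  refine ⟨_, X ^ (m + 1) * g, by simp [mul_coeff_zero], rfl, ?_⟩
  rw [map_mul, map_pow, aeval_X, zpow_add, Units.val_mul, zpow_natCast, Units.val_pow_eq_pow_val]
  ring

/-- When the lowest coefficient vanishes, the second one becomes the lowest: this is how a
cancellation raises the order by one. -/
theorem HasJet.raise (h : HasJet q f v 0 d) : ∃ d', HasJet q f (v + 1) d d' := by
  obtain ⟨g, hc, rfl, rfl⟩ := h
  obtain ⟨g', rfl⟩ := X_dvd_iff.2 hc
  refine ⟨_, g', by simp, rfl, ?_⟩
  rw [map_mul, aeval_X, zpow_add_one, Units.val_mul]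
  ring

theorem HasJet.zpow (m : ℤ) : HasJet q ((q ^ m : Rˣ) : R) m 1 0 :=
  ⟨1, by simp, by simp [coeff_one], by simp⟩

theorem HasJet.neg (h : HasJet q f v c d) : HasJet q (-f) v (-c) (-d) := by
  obtain ⟨g, rfl, rfl, rfl⟩ := h
  exact ⟨-g, by simp, by simp, by rw [map_neg]; ring⟩

theorem HasJet.hasOrder (h : HasJet q f v c d) (hc : c ≠ 0) : HasOrder q f v := ⟨c, d, hc, h⟩

/-- The ratio of the second to the lowest coefficient is additive under multiplication, like a
logarithmic derivative; hence the shape `s x * k x`. -/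
theorem HasJet.list_prod (φ : ℤ → R) (e s k : ℤ → ℤ) (L : List ℤ)
    (h : ∀ x ∈ L, HasJet q (φ x) (e x) (s x) (s x * k x)) :
    HasJet q (L.map φ).prod (L.map e).sum (L.map s).prod ((L.map s).prod * (L.map k).sum) := by
  induction L with
  | nil => simpa using HasJet.zpow (q := q) 0
  | cons x L ih =>
    simp only [List.map_cons, List.prod_cons, List.sum_cons]
    have := (h x (by simp)).mul (ih fun y hy => h y (by simp [hy]))
    convert this using 1
    ring

theorem HasOrder.mul (h : HasOrder q f v) (h' : HasOrder q f' v') :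
    HasOrder q (f * f') (v + v') := by
  obtain ⟨c, d, hc, h⟩ := h
  obtain ⟨c', d', hc', h'⟩ := h'
  exact (h.mul h').hasOrder (mul_ne_zero hc hc')

theorem HasOrder.pow (h : HasOrder q f v) (n : ℕ) : HasOrder q (f ^ n) (n * v) := by
  induction n with
  | zero => simpa using (HasJet.zpow (q := q) 0).hasOrder one_ne_zero
  | succ n ih =>
    rw [pow_succ]
    convert ih.mul h using 1
    push_cast
    ring

theorem HasOrder.neg (h : HasOrder q f v) : HasOrder q (-f) v := by
  obtain ⟨c, d, hc, h⟩ := h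
  exact h.neg.hasOrder (neg_ne_zero.2 hc)

theorem HasOrder.zpow (m : ℤ) : HasOrder q ((q ^ m : Rˣ) : R) m :=
  (HasJet.zpow m).hasOrder one_ne_zero

theorem HasOrder.add_of_lt (h : HasOrder q f v) (h' : HasOrder q f' v') (hv : v < v') :
    HasOrder q (f + f') v := by
  obtain ⟨c, d, hc, h⟩ := h
  obtain ⟨c', d', hc', h'⟩ := h'
  obtain ⟨d'', h''⟩ := h'.lower v hv
  exact (h.add h'').hasOrder (by simpa using hc)

theorem HasOrder.add_of_ne (h : HasOrder q f v) (h' : HasOrder q f' v') (hv : v ≠ v') :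
    HasOrder q (f + f') (min v v') := by
  rcases lt_or_gt_of_ne hv with hv | hv
  · rw [min_eq_left hv.le]
    exact h.add_of_lt h' hv
  · rw [min_eq_right hv.le, add_comm]
    exact h'.add_of_lt h hv

/-- Serves to pass from q = -A⁻⁴ and its inverse to A⁻¹ and A, with `k = 4`. -/
theorem HasOrder.of_neg_zpow {k : ℕ} (hk : k ≠ 0) (h : HasOrder (-q ^ k) f v) :
    HasOrder q f (k * v) := by
  obtain ⟨c, d, hc, g, rfl, -, rfl⟩ := h
  have h1 : HasOrder q (aeval ((-q ^ k : Rˣ) : R) g) 0 := by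
    refine ⟨_, _, hc, g.comp (-X ^ k), ?_, rfl, ?_⟩
    · simp [coeff_zero_eq_eval_zero, hk]
    · simp [aeval_comp]
  have h2 : HasOrder q (((-q ^ k) ^ v : Rˣ) : R) (k * v) := by
    rw [show (-q ^ k) ^ v = (-1) ^ v * q ^ (k * v) by
      rw [← neg_one_mul, mul_zpow, zpow_mul, zpow_natCast], Units.val_mul]
    rcases Int.even_or_odd v with hv | hv
    · rw [hv.neg_one_zpow, Units.val_one, one_mul]
      exact HasOrder.zpow _
    · rw [hv.neg_one_zpow, Units.val_neg, Units.val_one, neg_one_mul]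
      exact (HasOrder.zpow _).neg
  simpa using h2.mul h1

end Jets

/-! ### Orders in `A` and `A⁻¹`, and the span of the Jones polynomial -/

open LaurentPolynomial LinkDiagram

theorem aeval_eq_ringHom {R : Type*} [CommRing R] (φ : ℤ[X] →+* R) (x : R) (hx : φ X = x)
    (g : ℤ[X]) : aeval x g = φ g := by
  have : ((aeval x : ℤ[X] →ₐ[ℤ] R) : ℤ[X] →+* R) = φ :=
    Polynomial.ringHom_ext' (RingHom.ext_int _ _) (by simp [hx])
  exact DFunLike.congr_fun this g

theorem coeff_T_mul (v : ℤ) (f : ℤ[T;T⁻¹]) (k : ℤ) :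
    (T v * f).coeff k = f.coeff (k - v) := by
  have := AddMonoidAlgebra.coeff_single_mul_apply (R := ℤ) (x := f) (r := 1) (g := v) (h := k)
  rw [one_mul, neg_add_eq_sub] at this
  exact this

theorem coeff_T_mul_toLaurent (v : ℤ) (g : ℤ[X]) :
    (T v * toLaurent g).coeff v = g.coeff 0 ∧ ∀ k < v, (T v * toLaurent g).coeff k = 0 := by
  refine ⟨?_, fun k hk => ?_⟩
  · rw [coeff_T_mul, sub_self, coeff_toLaurent]
    exact Finsupp.mapDomain_apply Nat.cast_injective _ 0
  · rw [coeff_T_mul, ← Finsupp.notMem_support_iff, support_coeff_toLaurent]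
    simp only [Finset.mem_map, not_exists, not_and]
    intro m _ hm
    rw [Nat.castEmbedding_apply] at hm
    omega

theorem HasOrder.coeff {f : ℤ[T;T⁻¹]} {v : ℤ} (h : HasOrder unitA f v) :
    f.coeff v ≠ 0 ∧ ∀ k < v, f.coeff k = 0 := by
  obtain ⟨c, d, hc, g, rfl, -, hf⟩ := h
  rw [aeval_eq_ringHom toLaurent (unitA : ℤ[T;T⁻¹]) toLaurent_X, unitA_zpow] at hf
  rw [hf]
  have := coeff_T_mul_toLaurent v g
  exact ⟨by rw [this.1]; exact hc, this.2⟩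

theorem HasOrder.coeff_inv {f : ℤ[T;T⁻¹]} {v : ℤ} (h : HasOrder unitA⁻¹ f v) :
    f.coeff (-v) ≠ 0 ∧ ∀ k, -v < k → f.coeff k = 0 := by
  obtain ⟨c, d, hc, g, rfl, -, hf⟩ := h
  rw [aeval_eq_ringHom ((invert : ℤ[T;T⁻¹] ≃ₐ[ℤ] _).toRingHom.comp toLaurent)
    _ (by simp; rfl), inv_zpow', unitA_zpow] at hf
  have hf' : invert f = T v * toLaurent g := by
    rw [hf, map_mul, invert_T, neg_neg]
    congr 1
    exact involutive_invert _
  have := coeff_T_mul_toLaurent v g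
  rw [← hf'] at this
  simp only [invert_apply] at this
  refine ⟨by rw [this.1]; exact hc, fun k hk => ?_⟩
  have := this.2 (-k) (by omega)
  rwa [neg_neg] at this

theorem HasOrder.unique {f : ℤ[T;T⁻¹]} {v v' : ℤ} (h : HasOrder unitA f v)
    (h' : HasOrder unitA f v') : v = v' := by
  rcases lt_trichotomy v v' with hv | hv | hv
  · exact absurd (h'.coeff.2 v hv) h.coeff.1
  · exact hv
  · exact absurd (h.coeff.2 v' hv) h'.coeff.1

theorem HasOrder.unique_inv {f : ℤ[T;T⁻¹]} {v v' : ℤ} (h : HasOrder unitA⁻¹ f v)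
    (h' : HasOrder unitA⁻¹ f v') : v = v' := by
  rcases lt_trichotomy v v' with hv | hv | hv
  · exact absurd (h'.coeff_inv.2 (-v) (by omega)) h.coeff_inv.1
  · exact hv
  · exact absurd (h.coeff_inv.2 (-v') (by omega)) h'.coeff_inv.1

theorem exists_hasOrder {f : ℤ[T;T⁻¹]} (hf : f ≠ 0) : ∃ v, HasOrder unitA f v := by
  obtain ⟨m, g, hg⟩ := exists_T_pow f
  have hg0 : g ≠ 0 := by
    rintro rfl
    rw [map_zero, eq_comm, (isUnit_T (m : ℤ)).mul_left_eq_zero] at hg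
    exact hf hg
  obtain ⟨g', hg', hX⟩ := exists_eq_pow_rootMultiplicity_mul_and_not_dvd g hg0 0
  rw [C_0, sub_zero] at hg' hX
  refine ⟨(g.rootMultiplicity 0 : ℤ) - m, _, _, mt X_dvd_iff.2 hX, g', rfl, rfl, ?_⟩
  rw [aeval_eq_ringHom toLaurent (unitA : ℤ[T;T⁻¹]) toLaurent_X, unitA_zpow, T_sub, mul_right_comm,
    ← toLaurent_X_pow, ← map_mul, ← hg', hg, mul_T_assoc]
  simp

theorem exists_hasOrder_inv {f : ℤ[T;T⁻¹]} (hf : f ≠ 0) : ∃ v, HasOrder unitA⁻¹ f v := by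
  obtain ⟨v, c, d, hc, g, hg0, hg1, hg⟩ := exists_hasOrder
    (f := invert f) (by rwa [Ne, map_eq_zero_iff _ invert.injective])
  rw [aeval_eq_ringHom toLaurent (unitA : ℤ[T;T⁻¹]) toLaurent_X, unitA_zpow] at hg
  refine ⟨v, c, d, hc, g, hg0, hg1, ?_⟩
  rw [aeval_eq_ringHom ((invert : ℤ[T;T⁻¹] ≃ₐ[ℤ] _).toRingHom.comp toLaurent)
    _ (by simp; rfl), inv_zpow', unitA_zpow, ← involutive_invert f, hg, map_mul, invert_T]
  rfl

theorem hasOrder_delta : HasOrder unitA delta (-2) ∧ HasOrder unitA⁻¹ delta (-2) := by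
  have h1 : ∀ k : ℤ, HasOrder unitA (T k) k := fun k => by
    rw [← unitA_zpow]; exact HasOrder.zpow k
  have h2 : ∀ k : ℤ, HasOrder unitA⁻¹ (T k) (-k) := fun k => by
    have := HasOrder.zpow (q := unitA⁻¹) (-k)
    rwa [inv_zpow', neg_neg, unitA_zpow] at this
  rw [delta, sub_eq_add_neg]
  refine ⟨(h1 (-2)).neg.add_of_lt (h1 2).neg (by norm_num), ?_⟩
  rw [add_comm]
  exact (h2 2).neg.add_of_lt (h2 (-2)).neg (by norm_num)

/-- The exponent `k` of `A` becomes `-k / 4`, so the lowest power of `A` gives the highest power of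
`t`. -/
theorem tSpan_mapDomain {f : ℤ[T;T⁻¹]} {v w : ℤ} (h : HasOrder unitA f v)
    (h' : HasOrder unitA⁻¹ f w) :
    tSpan (AddMonoidAlgebra.mapDomain (fun k : ℤ => -(k : ℚ) / 4) f) = (-w - v : ℚ) / 4 := by
  have hinj : Function.Injective fun k : ℤ => -(k : ℚ) / 4 := fun k l hkl => by
    have : -(k : ℚ) / 4 = -(l : ℚ) / 4 := hkl
    field_simp at this
    exact_mod_cast neg_injective this
  have hsupp : (AddMonoidAlgebra.mapDomain (fun k : ℤ => -(k : ℚ) / 4) f).coeff.support =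
      f.coeff.support.image fun k : ℤ => -(k : ℚ) / 4 :=
    Finsupp.mapDomain_support_of_injective hinj _
  have hv := Finsupp.mem_support_iff.2 h.coeff.1
  have hw := Finsupp.mem_support_iff.2 h'.coeff_inv.1
  have hne : (f.coeff.support.image fun k : ℤ => -(k : ℚ) / 4).Nonempty := ⟨_,
    Finset.mem_image_of_mem _ hv⟩
  have hmax : (f.coeff.support.image fun k : ℤ => -(k : ℚ) / 4).max' hne = -(v : ℚ) / 4 := by
    refine le_antisymm (Finset.max'_le _ _ _ ?_)
      (Finset.le_max' _ _ (Finset.mem_image_of_mem (fun k : ℤ => -(k : ℚ) / 4) hv))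
    intro y hy
    obtain ⟨k, hk, rfl⟩ := Finset.mem_image.1 hy
    have : v ≤ k := not_lt.1 fun hc => Finsupp.mem_support_iff.1 hk (h.coeff.2 k hc)
    have : (v : ℚ) ≤ k := by exact_mod_cast this
    linarith
  have hmin : (f.coeff.support.image fun k : ℤ => -(k : ℚ) / 4).min' hne = (w : ℚ) / 4 := by
    refine le_antisymm ?_ (Finset.le_min' _ _ _ ?_)
    · have := Finset.min'_le _ _ (Finset.mem_image_of_mem (fun k : ℤ => -(k : ℚ) / 4) hw)
      simpa using this
    · intro y hy
      obtain ⟨k, hk, rfl⟩ := Finset.mem_image.1 hy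
      have : k ≤ -w := not_lt.1 fun hc => Finsupp.mem_support_iff.1 hk (h'.coeff_inv.2 k hc)
      have : (k : ℚ) ≤ -w := by exact_mod_cast this
      linarith
  unfold tSpan
  simp only [hsupp]
  rw [dif_pos hne, hmax, hmin]
  ring

/-- The span of the Jones polynomial of a pretzel diagram, from the orders of `pretzelPoly` in
`q` and in `q⁻¹`. -/
theorem jones_ne_zero_and_tSpan {n : ℕ} [NeZero n] (c : Fin n → ℤ) (o : (diagram c).Orientation)
    {v w : ℤ} (hv : HasOrder unitQ (pretzelPoly unitQ (List.ofFn c)) v)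
    (hw : HasOrder unitQ⁻¹ (pretzelPoly unitQ (List.ofFn c)) w) :
    (diagram c).jones o ≠ 0 ∧ tSpan ((diagram c).jones o) = ((-v - w - n : ℤ) : ℚ) := by
  set u : (ℤ[T;T⁻¹])ˣ := (-unitA) ^ (-3 * (diagram c).writhe o) with hu
  -- Since q = -(A⁻¹)⁴, orders in `q` are orders in `A⁻¹`, and those in `q⁻¹` are orders in `A`,
  -- each multiplied by 4.
  have hv' : HasOrder unitA⁻¹ (pretzelPoly unitQ (List.ofFn c)) (4 * v) := by
    refine HasOrder.of_neg_zpow (k := 4) (by norm_num) ?_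
    convert hv using 1
    rw [unitQ, inv_pow, ← zpow_natCast, ← zpow_neg]
    rfl
  have hw' : HasOrder unitA (pretzelPoly unitQ (List.ofFn c)) (4 * w) := by
    refine HasOrder.of_neg_zpow (k := 4) (by norm_num) ?_
    convert hw using 1
    rw [unitQ, inv_neg, ← zpow_neg, ← zpow_natCast]
    rfl
  have key : delta ^ n * (u * (diagram c).bracket) =
      u * (unitA ^ ∑ i, c i : (ℤ[T;T⁻¹])ˣ) * pretzelPoly unitQ (List.ofFn c) := by
    rw [unitA_zpow, mul_left_comm, delta_pow_mul_bracket, mul_assoc]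
  have hunit : ∃ e : ℤ, HasOrder unitA (u * (unitA ^ ∑ i, c i : (ℤ[T;T⁻¹])ˣ) : ℤ[T;T⁻¹]) e ∧
      HasOrder unitA⁻¹ (u * (unitA ^ ∑ i, c i : (ℤ[T;T⁻¹])ˣ) : ℤ[T;T⁻¹]) (-e) := by
    have h1 : ∀ k : ℤ, HasOrder unitA⁻¹ ((unitA ^ k : (ℤ[T;T⁻¹])ˣ) : ℤ[T;T⁻¹]) (-k) := fun k => by
      have := HasOrder.zpow (q := unitA⁻¹) (-k)
      rwa [inv_zpow', neg_neg] at this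
    refine ⟨-3 * (diagram c).writhe o + ∑ i, c i, ?_⟩
    rw [← Units.val_mul, hu]
    rcases Int.even_or_odd (-3 * (diagram c).writhe o) with he | he
    · rw [he.neg_zpow, ← zpow_add]
      exact ⟨HasOrder.zpow _, h1 _⟩
    · rw [he.neg_zpow, neg_mul, ← zpow_add, Units.val_neg]
      exact ⟨(HasOrder.zpow _).neg, (h1 _).neg⟩
  obtain ⟨e, he, he'⟩ := hunit
  have hJ0 : (u : ℤ[T;T⁻¹]) * (diagram c).bracket ≠ 0 := by
    intro h0
    have := (he.mul hw').coeff.1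
    rw [← key, h0, mul_zero] at this
    exact this rfl
  obtain ⟨x, hx⟩ := exists_hasOrder hJ0
  obtain ⟨y, hy⟩ := exists_hasOrder_inv hJ0
  -- δ has order -2 both in `A` and in `A⁻¹`; comparing the orders of the two sides of `key` yields
  -- the term `-n`, and the exponent `e` of the unit drops out.
  have hx' := (hasOrder_delta.1.pow n).mul hx
  have hy' := (hasOrder_delta.2.pow n).mul hy
  rw [key] at hx' hy'
  have ex := hx'.unique (he.mul hw')
  have ey := hy'.unique_inv (he'.mul hv')
  have hs := tSpan_mapDomain hx hy
  refine ⟨fun h0 => ?_, ?_⟩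
  · have h1 : AddMonoidAlgebra.mapDomain (fun k : ℤ => -(k : ℚ) / 4)
      ((u : ℤ[T;T⁻¹]) * (diagram c).bracket) = 0 := h0
    refine hJ0 (AddMonoidAlgebra.mapDomain_injective (fun k l hkl => ?_)
      (h1.trans (AddMonoidAlgebra.mapDomain_zero _).symm))
    have : -(k : ℚ) / 4 = -(l : ℚ) / 4 := hkl
    field_simp at this
    exact_mod_cast neg_injective this
  · refine hs.trans ?_
    have ex : (n : ℚ) * (-2) + x = e + 4 * w := by exact_mod_cast ex
    have ey : (n : ℚ) * (-2) + y = -e + 4 * v := by exact_mod_cast ey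
    push_cast
    linarith

end Pretzel

/-! ### The lowest exponent from the lowest terms of the factors -/

namespace Pretzel

open Polynomial

/-- The order of `q ^ x + φ` in `q`. -/
def lowFst (x : ℤ) : ℤ := if x < -1 then x else if x = -1 then 0 else -1

/-- The order of `q ^ x - 1` in `q`, for `x ≠ 0`. -/
def lowSnd (x : ℤ) : ℤ := if x < 0 then x else 0

/-- The lowest coefficient of `q ^ x + φ`, and of `q ^ x - 1` for `x ≠ 0`. -/
def lowSign (x : ℤ) : ℤ := if x < 0 then 1 else -1

/-- The ratio of the two lowest coefficients of `q ^ x + φ`. -/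
def ratioFst (x : ℤ) : ℤ := if x < -2 then 0 else if x = 0 then -2 else -1

/-- The ratio of the two lowest coefficients of `q ^ x - 1`. -/
def ratioSnd (x : ℤ) : ℤ := if x = 1 ∨ x = -1 then -1 else 0

theorem int_cases (x : ℤ) :
    (∃ m : ℕ, x = m + 2) ∨ x = 1 ∨ x = 0 ∨ x = -1 ∨ ∃ m : ℕ, x = -(m + 2 : ℕ) := by
  rcases lt_or_ge x (-1) with h | h
  · exact .inr <| .inr <| .inr <| .inr ⟨(-x - 2).toNat, by omega⟩
  · rcases lt_or_ge 1 x with h' | h'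
    · exact .inl ⟨(x - 2).toNat, by omega⟩
    · omega

section Factors

variable {R : Type*} [CommRing R] (q : Rˣ)

theorem hasJet_phi : HasJet q (1 - q - (q⁻¹ : Rˣ) : R) (-1) (-1) 1 := by
  have h : ((q⁻¹ : Rˣ) : R) * q = 1 := by simp
  refine ⟨-1 + X - X ^ 2, by simp, by simp [coeff_one, coeff_X_pow], ?_⟩
  simp only [map_add, map_sub, map_neg, map_one, map_pow, aeval_X, zpow_neg_one]
  linear_combination (q - 1 : R) * h

theorem hasJet_fst (x : ℤ) :
    HasJet q (((q ^ x : Rˣ) : R) + (1 - q - (q⁻¹ : Rˣ))) (lowFst x) (lowSign x)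
      (lowSign x * ratioFst x) := by
  have h : ((q⁻¹ : Rˣ) : R) * q = 1 := by simp
  rcases int_cases x with ⟨m, rfl⟩ | rfl | rfl | rfl | ⟨m, rfl⟩
  · have h1 : ¬ ((m : ℤ) + 2 < -1) := by omega
    have h2 : ¬ ((m : ℤ) + 2 = -1) := by omega
    have h3 : ¬ ((m : ℤ) + 2 < 0) := by omega
    have h4 : ¬ ((m : ℤ) + 2 = 0) := by omega
    have h5 : ¬ ((m : ℤ) + 2 < -2) := by omega
    simp only [lowFst, lowSign, ratioFst, h1, h2, h3, h4, h5, if_false]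
    refine ⟨-1 + X - X ^ 2 + X ^ (m + 3), by simp, by simp [coeff_one, coeff_X_pow], ?_⟩
    have e : q ^ ((m : ℤ) + 2) = q ^ (m + 2) := by
      rw [← zpow_natCast]; push_cast; rfl
    simp only [map_add, map_sub, map_neg, map_one, map_pow, aeval_X, zpow_neg_one, e,
      Units.val_pow_eq_pow_val]
    linear_combination (q - 1 - q ^ (m + 2) : R) * h
  · refine ⟨-1 + X, by simp [lowSign], by simp [coeff_one, lowSign, ratioFst], ?_⟩
    simp only [map_add, map_neg, map_one, aeval_X, lowFst]
    norm_num
    linear_combination -h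
  · refine ⟨-1 + 2 * X - X ^ 2, by simp [lowSign], ?_, ?_⟩
    · simp [coeff_one, lowSign, ratioFst, coeff_X_pow]
    · simp only [map_add, map_neg, map_one, aeval_X, lowFst, map_sub, map_mul, map_pow, map_ofNat]
      norm_num
      linear_combination (q - 2 : R) * h
  · refine ⟨1 - X, by simp [lowSign], by simp [coeff_one, lowSign, ratioFst], ?_⟩
    simp only [map_sub, map_one, aeval_X, lowFst]
    norm_num
  · have h1 : -((m + 2 : ℕ) : ℤ) < -1 := by omega
    have h2 : -((m + 2 : ℕ) : ℤ) < 0 := by omega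
    have h3 : ¬ (-((m + 2 : ℕ) : ℤ) = 0) := by omega
    simp only [lowFst, lowSign, ratioFst, h1, h2, h3, if_true, if_false, one_mul]
    refine ⟨1 - X ^ (m + 1) + X ^ (m + 2) - X ^ (m + 3), by simp, ?_, ?_⟩
    · rcases m with _ | m
      · simp [coeff_one, coeff_X_pow]
      · rw [if_pos (by push_cast; omega)]
        simp [coeff_one, coeff_X_pow]
    · have hk : (((q⁻¹ : Rˣ) : R)) ^ (m + 1) * q ^ (m + 1) = 1 := by
        rw [← mul_pow, h, one_pow]
      simp only [map_add, map_sub, map_one, map_pow, aeval_X, zpow_neg, zpow_natCast, ← inv_pow,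
        Units.val_pow_eq_pow_val]
      linear_combination ((q⁻¹ : Rˣ) - (q⁻¹ : Rˣ) * q + (q⁻¹ : Rˣ) * q ^ 2 : R) * hk -
        (1 - q : R) * h

theorem hasJet_snd {x : ℤ} (hx : x ≠ 0) :
    HasJet q (((q ^ x : Rˣ) : R) - 1) (lowSnd x) (lowSign x) (lowSign x * ratioSnd x) := by
  have h : ((q⁻¹ : Rˣ) : R) * q = 1 := by simp
  rcases int_cases x with ⟨m, rfl⟩ | rfl | rfl | rfl | ⟨m, rfl⟩
  · have h1 : ¬ ((m : ℤ) + 2 < 0) := by omega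
    have h2 : ¬ ((m : ℤ) + 2 = 1 ∨ (m : ℤ) + 2 = -1) := by omega
    simp only [lowSnd, lowSign, ratioSnd, h1, h2, if_false]
    refine ⟨X ^ (m + 2) - 1, by simp, by simp [coeff_one, coeff_X_pow], ?_⟩
    have e : q ^ ((m : ℤ) + 2) = q ^ (m + 2) := by
      rw [← zpow_natCast]; push_cast; rfl
    simp [e]
  · exact ⟨X - 1, by simp [lowSign], by simp [coeff_one, lowSign, ratioSnd], by simp [lowSnd]⟩
  · exact absurd rfl hx
  · refine ⟨1 - X, by simp [lowSign], by simp [coeff_one, lowSign, ratioSnd], ?_⟩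
    simp only [map_sub, map_one, aeval_X, lowSnd]
    norm_num
    linear_combination h
  · have h1 : -((m + 2 : ℕ) : ℤ) < 0 := by omega
    have h2 : ¬ (-((m + 2 : ℕ) : ℤ) = 1 ∨ -((m + 2 : ℕ) : ℤ) = -1) := by omega
    simp only [lowSnd, lowSign, ratioSnd, h1, h2, if_true, if_false, one_mul]
    refine ⟨1 - X ^ (m + 2), by simp, by simp [coeff_one, coeff_X_pow], ?_⟩
    have hk : (((q⁻¹ : Rˣ) : R)) ^ (m + 2) * q ^ (m + 2) = 1 := by
      rw [← mul_pow, h, one_pow]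
    simp only [map_sub, map_one, map_pow, aeval_X, zpow_neg, zpow_natCast, ← inv_pow,
      Units.val_pow_eq_pow_val]
    linear_combination hk

theorem pretzelPoly_neg (L : List ℤ) :
    pretzelPoly q (L.map Neg.neg) = pretzelPoly q⁻¹ L := by
  have h : (1 - q - (q⁻¹ : Rˣ) : R) = 1 - (q⁻¹ : Rˣ) - ((q⁻¹)⁻¹ : Rˣ) := by
    rw [inv_inv]; ring
  simp only [pretzelPoly, List.map_map, h, Function.comp_def, inv_zpow']

theorem pretzelPoly_perm {L L' : List ℤ} (h : L.Perm L') : pretzelPoly q L = pretzelPoly q L' := by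
  simp only [pretzelPoly, (h.map _).prod_eq]

end Factors

theorem prod_lowSign_ne_zero (L : List ℤ) : (L.map lowSign).prod ≠ 0 := by
  rw [Ne, List.prod_eq_zero_iff]
  simp only [List.mem_map, lowSign, not_exists, not_and]
  intro x _
  split_ifs <;> simp

/-- `v` is the lowest exponent of `q` in `pretzelPoly q L`. -/
def LowDeg (L : List ℤ) (v : ℤ) : Prop :=
  ∀ q : (ℤ[T;T⁻¹])ˣ, HasOrder q (pretzelPoly q L) v

/-- Taking `q` to be `unitA` makes the order visible in the coefficients. -/
theorem LowDeg.unique {L : List ℤ} {v v' : ℤ} (h : LowDeg L v) (h' : LowDeg L v') : v = v' :=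
  (h _).unique (h' _)

theorem LowDeg.perm {L L' : List ℤ} {v : ℤ} (hL : L.Perm L') (h : LowDeg L v) : LowDeg L' v :=
  fun q => pretzelPoly_perm q hL ▸ h q

theorem lowDeg_of_zero_mem {L : List ℤ} (h : 0 ∈ L) : LowDeg L (L.map lowFst).sum := by
  intro q
  have h1 := HasJet.list_prod (q := q) _ _ _ _ L fun x _ => hasJet_fst q x
  have h2 : (L.map fun x => ((q ^ x : (ℤ[T;T⁻¹])ˣ) : ℤ[T;T⁻¹]) - 1).prod = 0 :=
    List.prod_eq_zero_iff.2 (List.mem_map.2 ⟨0, h, by simp⟩)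
  rw [pretzelPoly, h2, mul_zero, add_zero]
  exact h1.hasOrder (prod_lowSign_ne_zero L)

theorem lowDeg_of_ne {L : List ℤ} (h : 0 ∉ L)
    (hne : (L.map lowFst).sum ≠ -1 + (L.map lowSnd).sum) :
    LowDeg L (min (L.map lowFst).sum (-1 + (L.map lowSnd).sum)) := by
  intro q
  have h1 := HasJet.list_prod (q := q) _ _ _ _ L fun x _ => hasJet_fst q x
  have h2 := HasJet.list_prod (q := q) _ _ _ _ L fun x hx =>
    hasJet_snd q (x := x) fun h0 => h (h0 ▸ hx)
  exact (h1.hasOrder (prod_lowSign_ne_zero L)).add_of_ne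
    (((hasJet_phi q).mul h2).hasOrder (mul_ne_zero (by norm_num) (prod_lowSign_ne_zero L))) hne

/-- Corresponding factors of the two products have the same lowest coefficient and φ starts with -1,
so equal lowest exponents always cancel. The second coefficients survive if the sums of ratios
differ; the `-1` is the ratio of φ. -/
theorem lowDeg_of_eq {L : List ℤ} (h : 0 ∉ L)
    (heq : (L.map lowFst).sum = -1 + (L.map lowSnd).sum)
    (hne : (L.map ratioFst).sum ≠ -1 + (L.map ratioSnd).sum) :
    LowDeg L ((L.map lowFst).sum + 1) := by
  intro q
  have h1 := HasJet.list_prod (q := q) _ _ _ _ L fun x _ => hasJet_fst q x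
  have h2 := HasJet.list_prod (q := q) _ _ _ _ L fun x hx =>
    hasJet_snd q (x := x) fun h0 => h (h0 ▸ hx)
  have h3 := (hasJet_phi q).mul h2
  rw [← heq] at h3
  have h4 := h1.add h3
  rw [show (L.map lowSign).prod + -1 * (L.map lowSign).prod = 0 by ring] at h4
  obtain ⟨d, hd⟩ := h4.raise
  refine hd.hasOrder ?_
  rw [show (L.map lowSign).prod * (L.map ratioFst).sum + (-1 * ((L.map lowSign).prod *
    (L.map ratioSnd).sum) + 1 * (L.map lowSign).prod) = (L.map lowSign).prod *
    ((L.map ratioFst).sum - (-1 + (L.map ratioSnd).sum)) by ring]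
  exact mul_ne_zero (prod_lowSign_ne_zero L) (sub_ne_zero.2 hne)

/-- `q ^ x + φ` and `q ^ x - 1`, multiplied by `q ^ (|x| + 1)`. -/
theorem aeval_factor {R : Type*} [CommRing R] (q : Rˣ) (x : ℤ) :
    ((q ^ x : Rˣ) : R) + (1 - q - (q⁻¹ : Rˣ)) = (q ^ (-(x.natAbs + 1 : ℤ)) : Rˣ) *
      aeval (q : R) (X ^ (x.natAbs + 1 + x).toNat + X ^ x.natAbs * (X - X ^ 2 - 1) : ℤ[X]) ∧
    ((q ^ x : Rˣ) : R) - 1 = (q ^ (-(x.natAbs + 1 : ℤ)) : Rˣ) *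
      aeval (q : R) (X ^ (x.natAbs + 1 + x).toNat - X ^ (x.natAbs + 1) : ℤ[X]) := by
  have key : ∀ m : ℕ, (q ^ (-(x.natAbs + 1 : ℤ)) : Rˣ) * (q : R) ^ m =
      (q ^ (m - (x.natAbs + 1 : ℤ)) : Rˣ) := fun m => by
    rw [sub_eq_neg_add, zpow_add, Units.val_mul, zpow_natCast, Units.val_pow_eq_pow_val]
  have k1 := key (x.natAbs + 1 + x).toNat
  have k2 := key x.natAbs
  have k3 := key (x.natAbs + 1)
  have k4 := key (x.natAbs + 2)
  rw [show ((x.natAbs + 1 + x).toNat - (x.natAbs + 1 : ℤ)) = x by omega] at k1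
  rw [show ((x.natAbs : ℤ) - (x.natAbs + 1 : ℤ)) = -1 by omega, zpow_neg_one] at k2
  rw [show (((x.natAbs + 1 : ℕ) : ℤ) - (x.natAbs + 1 : ℤ)) = 0 by push_cast; ring, zpow_zero,
    Units.val_one] at k3
  rw [show (((x.natAbs + 2 : ℕ) : ℤ) - (x.natAbs + 1 : ℤ)) = 1 by push_cast; ring, zpow_one] at k4
  simp only [map_add, map_sub, map_mul, map_one, map_pow, aeval_X]
  exact ⟨by linear_combination -k1 + k2 - k3 + k4, by linear_combination -k1 + k3⟩

theorem list_prod_aeval {R ι : Type*} [CommRing R] (q : Rˣ) (φ : ι → R) (e : ι → ℤ)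
    (g : ι → ℤ[X]) (h : ∀ x, φ x = (q ^ e x : Rˣ) * aeval (q : R) (g x)) (L : List ι) :
    (L.map φ).prod = (q ^ (L.map e).sum : Rˣ) * aeval (q : R) (L.map g).prod := by
  induction L with
  | nil => simp
  | cons x L ih =>
    simp only [List.map_cons, List.prod_cons, List.sum_cons, ih, h x, map_mul, zpow_add,
      Units.val_mul]
    ring

theorem HasOrder.of_aeval {R : Type*} [CommRing R] {q : Rˣ} {f : R} {e : ℤ} {m : ℕ} {H : ℤ[X]}
    (hf : f = (q ^ e : Rˣ) * aeval (q : R) (X ^ m * H)) (hH : H.coeff 0 ≠ 0) :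
    HasOrder q f (e + m) := by
  refine ⟨_, _, hH, H, rfl, rfl, ?_⟩
  rw [hf, map_mul, map_pow, aeval_X, zpow_add, Units.val_mul, zpow_natCast,
    Units.val_pow_eq_pow_val, mul_assoc]

theorem pretzelPoly_eq_aeval {R : Type*} [CommRing R] (q : Rˣ) (L : List ℤ) :
    pretzelPoly q L = (q ^ ((L.map fun x : ℤ => -(x.natAbs + 1 : ℤ)).sum - 1) : Rˣ) *
      aeval (q : R) (X * (L.map fun x : ℤ =>
          (X ^ (x.natAbs + 1 + x).toNat + X ^ x.natAbs * (X - X ^ 2 - 1) : ℤ[X])).prod +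
        (X - X ^ 2 - 1) * (L.map fun x : ℤ =>
          (X ^ (x.natAbs + 1 + x).toNat - X ^ (x.natAbs + 1) : ℤ[X])).prod) := by
  have h : ((q⁻¹ : Rˣ) : R) * q = 1 := by simp
  rw [pretzelPoly, list_prod_aeval q _ _ _ fun x => (aeval_factor q x).1,
    list_prod_aeval q _ _ _ fun x => (aeval_factor q x).2]
  simp only [map_add, map_sub, map_mul, map_one, map_pow, aeval_X, zpow_sub_one, Units.val_mul]
  have key : ∀ E A B t y : R, y * t = 1 →
      E * A + (1 - t - y) * (E * B) = E * y * (t * A + (t - t ^ 2 - 1) * B) :=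
    fun E A B t y hy => by linear_combination (-(E * A + E * B * (1 - t))) * hy
  exact key _ _ _ _ _ h

/-- It suffices that the numerator does not vanish at q = -1 (that is, at t = 1). There the factors
of the second product are 0 for even entries, and those of the first never vanish. If all entries
are odd, the two terms are 2^l and 3 · 2^l up to sign, `l` being the number of entries. -/
theorem exists_lowDeg (L : List ℤ) : ∃ v, LowDeg L v := by
  let g₁ : ℤ → ℤ[X] := fun x => X ^ (x.natAbs + 1 + x).toNat + X ^ x.natAbs * (X - X ^ 2 - 1)
  let g₂ : ℤ → ℤ[X] := fun x => X ^ (x.natAbs + 1 + x).toNat - X ^ (x.natAbs + 1)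
  let G : ℤ[X] := X * (L.map g₁).prod + (X - X ^ 2 - 1) * (L.map g₂).prod
  have hG : G ≠ 0 := by
    -- `|x| + x` is even.
    have hodd : ∀ x : ℤ, ((-1 : ℤ)) ^ (x.natAbs + 1 + x).toNat = -1 := fun x => by
      refine Odd.neg_one_pow ?_
      rw [Nat.odd_iff]
      omega
    have h1 : ∀ x : ℤ, (g₁ x).eval (-1) = -1 - 3 * (-1) ^ x.natAbs := fun x => by
      simp only [g₁, eval_add, eval_sub, eval_mul, eval_pow, eval_X, eval_one, hodd]; ring
    have h2 : ∀ x : ℤ, (g₂ x).eval (-1) = -1 + (-1) ^ x.natAbs := fun x => by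
      simp only [g₂, eval_sub, eval_pow, eval_X, hodd]; ring
    intro h0
    have h3 := congrArg (eval (-1)) h0
    simp only [G, eval_add, eval_mul, eval_sub, eval_X, eval_pow, eval_one, eval_zero,
      eval_list_prod, List.map_map, Function.comp_def, h1, h2] at h3
    by_cases hex : ∃ x ∈ L, Even x.natAbs
    · obtain ⟨x, hx, hxe⟩ := hex
      have h4 : (L.map fun x => (-1 : ℤ) + (-1) ^ x.natAbs).prod = 0 :=
        List.prod_eq_zero_iff.2 (List.mem_map.2 ⟨x, hx, by simp [hxe.neg_one_pow]⟩)
      have h5 : (L.map fun x => (-1 : ℤ) - 3 * (-1) ^ x.natAbs).prod ≠ 0 := by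
        rw [Ne, List.prod_eq_zero_iff]
        simp only [List.mem_map, not_exists, not_and]
        intro y _
        rcases neg_one_pow_eq_or ℤ y.natAbs with hy | hy <;> rw [hy] <;> norm_num
      rw [h4] at h3
      exact h5 (by linarith)
    · push Not at hex
      have h4 : (L.map fun x => (-1 : ℤ) + (-1) ^ x.natAbs) = L.map fun _ => -2 :=
        List.map_congr_left fun x hx => by
          rw [(Nat.not_even_iff_odd.1 (hex x hx)).neg_one_pow]; norm_num
      have h5 : (L.map fun x => (-1 : ℤ) - 3 * (-1) ^ x.natAbs) = L.map fun _ => 2 :=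
        List.map_congr_left fun x hx => by
          rw [(Nat.not_even_iff_odd.1 (hex x hx)).neg_one_pow]; norm_num
      rw [h4, h5] at h3
      simp only [List.map_const', List.prod_replicate] at h3
      rw [neg_pow (2 : ℤ) L.length] at h3
      have h6 : (0 : ℤ) < 2 ^ L.length := by positivity
      rcases neg_one_pow_eq_or ℤ L.length with hy | hy <;> rw [hy] at h3 <;> linarith
  obtain ⟨G', hG', hX⟩ := exists_eq_pow_rootMultiplicity_mul_and_not_dvd G hG 0
  rw [C_0, sub_zero] at hG' hX
  exact ⟨_, fun q => HasOrder.of_aeval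
    ((pretzelPoly_eq_aeval q L).trans (by rw [← hG'])) (mt X_dvd_iff.2 hX)⟩

end Pretzel

/-! ### One positive entry: reduction to a polynomial numerator -/

namespace Pretzel

open Polynomial

/-- The polynomial `1 - X + X ^ 2`. -/
noncomputable def cyc : ℤ[X] := 1 - X + X ^ 2

/-- `∏ (1 - (1 - X + X ^ 2) X ^ c)`. -/
noncomputable def prodFst (B : List ℕ) : ℤ[X] := (B.map fun c => 1 - cyc * X ^ c).prod

/-- `∏ (1 - X ^ (c + 1))`. -/
noncomputable def prodSnd (B : List ℕ) : ℤ[X] := (B.map fun c => 1 - X ^ (c + 1)).prod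

/-- The numerator of `pretzelPoly` for one positive entry `a` and the negative entries
`-(c + 1)`, where `c` is in `B`. -/
noncomputable def numer (a : ℕ) (B : List ℕ) : ℤ[X] :=
  (X ^ (a + 1) - cyc) * prodFst B + cyc * (1 - X ^ a) * prodSnd B

theorem prodFst_cons (c : ℕ) (B : List ℕ) :
    prodFst (c :: B) = (1 - cyc * X ^ c) * prodFst B := by simp [prodFst]

theorem prodSnd_cons (c : ℕ) (B : List ℕ) :
    prodSnd (c :: B) = (1 - X ^ (c + 1)) * prodSnd B := by simp [prodSnd]

theorem coeff_zero_prodFst {B : List ℕ} (hB : ∀ c ∈ B, 1 ≤ c) : (prodFst B).coeff 0 = 1 := by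
  induction B with
  | nil => simp [prodFst]
  | cons c B ih =>
    have hc : c ≠ 0 := by have := hB c (by simp); omega
    rw [prodFst_cons, mul_coeff_zero, ih fun x hx => hB x (by simp [hx])]
    simp [hc.symm, coeff_X_pow]

/-- Corresponding factors differ by (1 - X^(c+1)) - (1 - cyc X^c) = X^c (1 - X)². Telescoping the
products, each factor with `c = m` adds 1 to the coefficient of `X ^ m`, and larger `c` add nothing.
-/
theorem exists_prodSnd_sub {B : List ℕ} {m : ℕ} (hm : 1 ≤ m) (hB : ∀ c ∈ B, m ≤ c) :
    ∃ E : ℤ[X], prodSnd B - prodFst B = X ^ m * E ∧ E.coeff 0 = B.count m := by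
  induction B with
  | nil => exact ⟨0, by simp [prodSnd, prodFst], by simp⟩
  | cons c B ih =>
    have hB' : ∀ x ∈ B, m ≤ x := fun x hx => hB x (by simp [hx])
    obtain ⟨E, hE, hE0⟩ := ih hB'
    obtain ⟨j, rfl⟩ := Nat.exists_eq_add_of_le (hB c (by simp))
    refine ⟨(1 - X ^ (m + j + 1)) * E + X ^ j * (1 - X) ^ 2 * prodFst B, ?_, ?_⟩
    · rw [prodFst_cons, prodSnd_cons, cyc]
      linear_combination (1 - X ^ (m + j + 1)) * hE
    · have h1 := coeff_zero_prodFst fun x hx => hm.trans (hB' x hx)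
      rw [coeff_add, mul_coeff_zero, mul_coeff_zero, h1, hE0]
      by_cases hj : j = 0
      · subst hj
        simp [coeff_zero_eq_eval_zero]
      · rw [List.count_cons_of_ne (by omega)]
        simp [coeff_zero_eq_eval_zero, hj]

/-- `X ^ v` is the highest power of `X` dividing `G`. -/
def HasVal (G : ℤ[X]) (v : ℕ) : Prop := ∃ H : ℤ[X], G = X ^ v * H ∧ H.coeff 0 ≠ 0

section Base

variable {G U W : ℤ[X]} {w m : ℕ} {B : List ℕ}

/-- The first summand starts with `U(0) X ^ w`, the second with the multiplicity of `m` times `X ^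
m`; the three claims are the three outcomes of the comparison. -/
theorem hasVal_of_base (hG : G = X ^ w * U * prodFst B + W * (prodSnd B - prodFst B))
    (hW : W.coeff 0 = 1) (hm : 1 ≤ m) (hB : ∀ c ∈ B, m ≤ c) :
    (m < w → B.count m ≠ 0 → HasVal G m) ∧ (w < m → U.coeff 0 ≠ 0 → HasVal G w) ∧
    (w = m → U.coeff 0 + B.count m ≠ 0 → HasVal G w) := by
  obtain ⟨E, hE, hE0⟩ := exists_prodSnd_sub hm hB
  have h1 := coeff_zero_prodFst fun x hx => hm.trans (hB x hx)
  rw [hE] at hG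
  refine ⟨fun h hc => ?_, fun h hc => ?_, fun h hc => ?_⟩
  · obtain ⟨j, rfl⟩ := Nat.exists_eq_add_of_lt h
    refine ⟨X ^ (j + 1) * U * prodFst B + W * E, by rw [hG]; ring, ?_⟩
    simpa [mul_coeff_zero, hW, hE0] using hc
  · obtain ⟨j, rfl⟩ := Nat.exists_eq_add_of_lt h
    refine ⟨U * prodFst B + W * X ^ (j + 1) * E, by rw [hG]; ring, ?_⟩
    simpa [mul_coeff_zero, h1] using hc
  · subst h
    refine ⟨U * prodFst B + W * E, by rw [hG]; ring, ?_⟩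
    simpa [mul_coeff_zero, hW, h1, hE0] using hc

theorem hasVal_of_base_nil (hG : G = X ^ w * U * prodFst [] + W * (prodSnd [] - prodFst []))
    (hW : W.coeff 0 = 1) (hU : U.coeff 0 ≠ 0) : HasVal G w :=
  -- For the empty list any lower bound is admissible, so it may be taken above `w`.
  (hasVal_of_base (m := w + 1) hG hW (by omega) (by simp)).2.1 (by omega) hU

/-- A positive `U(0)` cannot cancel a multiplicity, so the comparison ends here. -/
theorem hasVal_of_base_min (hG : G = X ^ w * U * prodFst B + W * (prodSnd B - prodFst B))
    (hW : W.coeff 0 = 1) (hU : 0 < U.coeff 0) (hm : 1 ≤ m) (hB : ∀ c ∈ B, m ≤ c)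
    (hmB : m ∈ B) : HasVal G (min m w) := by
  have h := hasVal_of_base hG hW hm hB
  have hc : 0 < B.count m := List.count_pos_iff.2 hmB
  rcases lt_trichotomy m w with hlt | heq | hlt
  · rw [min_eq_left hlt.le]
    exact h.1 hlt hc.ne'
  · rw [heq, min_self]
    exact h.2.2 heq.symm (by omega)
  · rw [min_eq_right hlt.le]
    exact h.2.1 hlt hU.ne'

end Base

section Numer

variable (a : ℕ) (B : List ℕ)

/-- Here `U(0) = -1`, so cancellation needs min B = a with multiplicity one. -/
theorem numer_eq : numer a B = X ^ a * -(1 - X) ^ 2 * prodFst B +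
    cyc * (1 - X ^ a) * (prodSnd B - prodFst B) := by
  rw [numer, cyc]
  ring

/-- The form after that cancellation. The sign is again negative, so a single next entry `a + 1`
cancels once more. -/
theorem numer_cons_eq : numer a (a :: B) = X ^ (a + 1) * -(1 - X) ^ 3 * prodFst B +
    cyc * (1 - X ^ a) * (1 - X ^ (a + 1)) * (prodSnd B - prodFst B) := by
  rw [numer, prodFst_cons, prodSnd_cons, cyc]
  ring

/-- After two cancellations. For `a ≥ 3` the constant term of `U` is 1 and no further cancellation
is possible. -/
theorem numer_cons_cons_eq (hb : 3 ≤ a) : numer a (a :: (a + 1) :: B) =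
    X ^ (a + 3) * ((1 - X) ^ 2 * (1 - cyc * X ^ (a - 2) - cyc * X ^ a + cyc * X ^ (2 * a - 1))) *
      prodFst B +
    cyc * (1 - X ^ a) * (1 - X ^ (a + 1)) * (1 - X ^ (a + 2)) * (prodSnd B - prodFst B) := by
  obtain ⟨j, rfl⟩ := Nat.exists_eq_add_of_le hb
  rw [numer, prodFst_cons, prodFst_cons, prodSnd_cons, prodSnd_cons, cyc,
    show 3 + j - 2 = j + 1 by omega, show 2 * (3 + j) - 1 = 2 * j + 5 by omega]
  ring

/-- For `a = 2` the term cyc X^(a-2) of the general formula is cyc, and 1 - cyc = X(1 - X) raises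
the exponent from 5 to 6. -/
theorem numer_two_eq : numer 2 (2 :: 3 :: B) =
    X ^ 6 * ((1 - X) ^ 2 * ((1 - X) - cyc * X + cyc * X ^ 2)) * prodFst B +
    cyc * (1 - X ^ 2) * (1 - X ^ 3) * (1 - X ^ 4) * (prodSnd B - prodFst B) := by
  rw [numer, prodFst_cons, prodFst_cons, prodSnd_cons, prodSnd_cons, cyc]
  ring

/-- For `a = 1` the term cyc X^(a-2) dominates: the exponent falls from 4 to 3 and the sign stays
negative, so a single entry 3 cancels a third time. -/
theorem numer_one_eq : numer 1 (1 :: 2 :: B) = X ^ 3 * -(1 - X) ^ 4 * prodFst B +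
    cyc * (1 - X) * (1 - X ^ 2) * (1 - X ^ 3) * (prodSnd B - prodFst B) := by
  rw [numer, prodFst_cons, prodFst_cons, prodSnd_cons, prodSnd_cons, cyc]
  ring

theorem numer_one_three_eq : numer 1 (1 :: 2 :: 3 :: B) =
    X ^ 6 * ((1 - X) ^ 4 * (cyc - X ^ 3)) * prodFst B +
    cyc * (1 - X) * (1 - X ^ 2) * (1 - X ^ 3) * (1 - X ^ 4) * (prodSnd B - prodFst B) := by
  rw [numer, prodFst_cons, prodFst_cons, prodFst_cons, prodSnd_cons, prodSnd_cons, prodSnd_cons,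
    cyc]
  ring

end Numer

/-- The list of the entries `a, -(c₁ + 1), -(c₂ + 1), …`. -/
def onePos (a : ℕ) (B : List ℕ) : List ℤ := (a : ℤ) :: B.map fun c : ℕ => -((c : ℤ) + 1)

/-- The powers of q are extracted factor by factor, using φ = -q⁻¹(1 - q + q²). -/
theorem pretzelPoly_onePos {R : Type*} [CommRing R] (q : Rˣ) (a : ℕ) (B : List ℕ) :
    pretzelPoly q (onePos a B) =
      (q ^ (-1 + (B.map fun c : ℕ => -((c : ℤ) + 1)).sum) : Rˣ) * aeval (q : R) (numer a B) := by
  have h : ((q⁻¹ : Rˣ) : R) * q = 1 := by simp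
  have hneg : ∀ c : ℕ, ((q ^ (-((c : ℤ) + 1)) : Rˣ) : R) * (q : R) ^ c = (q⁻¹ : Rˣ) := fun c => by
    rw [← Units.val_pow_eq_pow_val, ← zpow_natCast, ← Units.val_mul, ← zpow_add, ← zpow_neg_one]
    congr 2
    ring
  have e : ((q ^ (a : ℤ) : Rˣ) : R) = (q : R) ^ a := by simp
  have h1 : (B.map fun c : ℕ => ((q ^ (-((c : ℤ) + 1)) : Rˣ) : R) + (1 - q - (q⁻¹ : Rˣ))).prod =
      (q ^ (B.map fun c : ℕ => -((c : ℤ) + 1)).sum : Rˣ) * aeval (q : R) (prodFst B) := by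
    refine list_prod_aeval q _ _ _ (fun c => ?_) B
    simp only [map_sub, map_mul, map_one, map_pow, aeval_X, cyc, map_add]
    linear_combination (1 - q + q ^ 2 : R) * hneg c + (q - 1 : R) * h
  have h2 : (B.map fun c : ℕ => ((q ^ (-((c : ℤ) + 1)) : Rˣ) : R) - 1).prod =
      (q ^ (B.map fun c : ℕ => -((c : ℤ) + 1)).sum : Rˣ) * aeval (q : R) (prodSnd B) := by
    refine list_prod_aeval q _ _ _ (fun c => ?_) B
    simp only [map_sub, map_one, map_pow, aeval_X]
    linear_combination (q : R) * hneg c + h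
  simp only [pretzelPoly, onePos, List.map_cons, List.map_map, Function.comp_def, List.prod_cons,
    h1, h2, e]
  simp only [numer, map_add, map_sub, map_mul, map_pow, map_one, aeval_X, zpow_add, Units.val_mul,
    cyc, zpow_neg_one]
  have key : ∀ E A B t y s : R, y * t = 1 →
      (s + (1 - t - y)) * (E * A) + (1 - t - y) * ((s - 1) * (E * B)) =
      y * E * ((s * t - (1 - t + t ^ 2)) * A + (1 - t + t ^ 2) * (1 - s) * B) :=
    fun E A B t y s hy => by
      linear_combination (-(E * A * (s + 1 - t)) - E * B * (s - 1) * (1 - t)) * hy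
  rw [pow_succ]
  exact key _ _ _ _ _ _ h

theorem lowDeg_onePos {a : ℕ} {B : List ℕ} {v : ℕ} (h : HasVal (numer a B) v) :
    LowDeg (onePos a B) (-1 + (B.map fun c : ℕ => -((c : ℤ) + 1)).sum + v) := by
  intro q
  obtain ⟨H, hH, hH0⟩ := h
  exact HasOrder.of_aeval (by rw [pretzelPoly_onePos, hH]) hH0

end Pretzel

/-! ### One positive entry: the valuation in all cases -/

namespace Pretzel

open Polynomial

section Valuations

variable {a c : ℕ} {B : List ℕ}

theorem coeff_zero_cyc : cyc.coeff 0 = 1 := by simp [cyc]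

theorem hasVal_numer_nil (ha : 1 ≤ a) : HasVal (numer a []) a := by
  have : a ≠ 0 := by omega
  exact hasVal_of_base_nil (numer_eq a [])
    (by simp [mul_coeff_zero, coeff_zero_cyc, coeff_X_pow, this.symm])
    (by simp [coeff_zero_eq_eval_zero])

theorem hasVal_numer_ne (ha : 1 ≤ a) (hc : 1 ≤ c) (hB : ∀ x ∈ c :: B, c ≤ x) (hne : a ≠ c) :
    HasVal (numer a (c :: B)) (min a c) := by
  have ha' : a ≠ 0 := by omega
  have h := hasVal_of_base (numer_eq a (c :: B))
    (by simp [mul_coeff_zero, coeff_zero_cyc, coeff_X_pow, ha'.symm]) hc hB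
  rcases lt_or_gt_of_ne hne with hlt | hlt
  · rw [min_eq_left hlt.le]
    exact h.2.1 hlt (by simp [coeff_zero_eq_eval_zero])
  · rw [min_eq_right hlt.le]
    exact h.1 hlt (by simp)

theorem hasVal_numer_eq_eq (ha : 1 ≤ a) (hB : ∀ x ∈ B, a ≤ x) :
    HasVal (numer a (a :: a :: B)) a := by
  have ha' : a ≠ 0 := by omega
  have h := hasVal_of_base (numer_eq a (a :: a :: B))
    (by simp [mul_coeff_zero, coeff_zero_cyc, coeff_X_pow, ha'.symm]) ha (by simpa using hB)
  refine h.2.2 rfl ?_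
  simp only [coeff_zero_eq_eval_zero, List.count_cons_self]
  simp
  omega

theorem coeff_zero_numer_cons_weight (ha : 1 ≤ a) :
    (cyc * (1 - X ^ a) * (1 - X ^ (a + 1))).coeff 0 = 1 := by
  have ha' : a ≠ 0 := by omega
  simp [mul_coeff_zero, coeff_zero_cyc, coeff_X_pow, ha'.symm]

theorem hasVal_numer_single (ha : 1 ≤ a) : HasVal (numer a [a]) (a + 1) :=
  hasVal_of_base_nil (numer_cons_eq a []) (coeff_zero_numer_cons_weight ha)
    (by simp [coeff_zero_eq_eval_zero])

theorem hasVal_numer_eq_lt (ha : 1 ≤ a) (hB : ∀ x ∈ B, c ≤ x) (hc : a + 2 ≤ c) :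
    HasVal (numer a (a :: c :: B)) (a + 1) :=
  (hasVal_of_base (m := c) (numer_cons_eq a (c :: B)) (coeff_zero_numer_cons_weight ha)
    (by omega) (by simpa using hB)).2.1 (by omega) (by simp [coeff_zero_eq_eval_zero])

theorem hasVal_numer_succ_succ (ha : 1 ≤ a) (hB : ∀ x ∈ B, a + 1 ≤ x) :
    HasVal (numer a (a :: (a + 1) :: (a + 1) :: B)) (a + 1) := by
  refine (hasVal_of_base (m := a + 1) (numer_cons_eq a ((a + 1) :: (a + 1) :: B))
    (coeff_zero_numer_cons_weight ha) (by omega) (by simpa using hB)).2.2 rfl ?_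
  simp only [coeff_zero_eq_eval_zero, List.count_cons_self]
  simp
  omega

theorem coeff_zero_numer_cons_cons (ha : 3 ≤ a) :
    ((1 - X) ^ 2 * (1 - cyc * X ^ (a - 2) - cyc * X ^ a + cyc * X ^ (2 * a - 1))).coeff 0 = 1 ∧
    (cyc * (1 - X ^ a) * (1 - X ^ (a + 1)) * (1 - X ^ (a + 2))).coeff 0 = 1 := by
  have h1 : a ≠ 0 := by omega
  have h2 : a - 2 ≠ 0 := by omega
  have h3 : 2 * a - 1 ≠ 0 := by omega
  simp only [coeff_zero_eq_eval_zero]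
  simp [h1, h2, h3, cyc]

theorem hasVal_numer_pair (ha : 3 ≤ a) : HasVal (numer a [a, a + 1]) (a + 3) :=
  hasVal_of_base_nil (numer_cons_cons_eq a [] ha) (coeff_zero_numer_cons_cons ha).2
    (by rw [(coeff_zero_numer_cons_cons ha).1]; norm_num)

theorem hasVal_numer_pair_cons (ha : 3 ≤ a) (hc : a + 2 ≤ c) (hB : ∀ x ∈ B, c ≤ x) :
    HasVal (numer a (a :: (a + 1) :: c :: B)) (min c (a + 3)) :=
  hasVal_of_base_min (numer_cons_cons_eq a (c :: B) ha) (coeff_zero_numer_cons_cons ha).2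
    (by rw [(coeff_zero_numer_cons_cons ha).1]; norm_num) (by omega) (by simpa using hB) (by simp)

theorem hasVal_numer_two : HasVal (numer 2 [2, 3]) 6 :=
  hasVal_of_base_nil (numer_two_eq []) (by simp [coeff_zero_eq_eval_zero, cyc])
    (by simp [coeff_zero_eq_eval_zero])

theorem hasVal_numer_two_cons (hc : 4 ≤ c) (hB : ∀ x ∈ B, c ≤ x) :
    HasVal (numer 2 (2 :: 3 :: c :: B)) (min c 6) :=
  hasVal_of_base_min (numer_two_eq (c :: B)) (by simp [coeff_zero_eq_eval_zero, cyc])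
    (by simp [coeff_zero_eq_eval_zero]) (by omega) (by simpa using hB) (by simp)

theorem hasVal_numer_one : HasVal (numer 1 [1, 2]) 3 :=
  hasVal_of_base_nil (numer_one_eq []) (by simp [coeff_zero_eq_eval_zero, cyc])
    (by simp [coeff_zero_eq_eval_zero])

theorem hasVal_numer_one_lt (hc : 4 ≤ c) (hB : ∀ x ∈ B, c ≤ x) :
    HasVal (numer 1 (1 :: 2 :: c :: B)) 3 :=
  (hasVal_of_base (m := c) (numer_one_eq (c :: B)) (by simp [coeff_zero_eq_eval_zero, cyc])
    (by omega) (by simpa using hB)).2.1 (by omega) (by simp [coeff_zero_eq_eval_zero])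

theorem hasVal_numer_one_three_three (hB : ∀ x ∈ B, 3 ≤ x) :
    HasVal (numer 1 (1 :: 2 :: 3 :: 3 :: B)) 3 := by
  refine (hasVal_of_base (m := 3) (numer_one_eq (3 :: 3 :: B))
    (by simp [coeff_zero_eq_eval_zero, cyc]) (by omega) (by simpa using hB)).2.2 rfl ?_
  simp only [coeff_zero_eq_eval_zero, List.count_cons_self]
  simp
  omega

theorem hasVal_numer_one_three : HasVal (numer 1 [1, 2, 3]) 6 :=
  hasVal_of_base_nil (numer_one_three_eq []) (by simp [coeff_zero_eq_eval_zero, cyc])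
    (by simp [coeff_zero_eq_eval_zero, cyc])

theorem hasVal_numer_one_three_cons (hc : 4 ≤ c) (hB : ∀ x ∈ B, c ≤ x) :
    HasVal (numer 1 (1 :: 2 :: 3 :: c :: B)) (min c 6) :=
  hasVal_of_base_min (numer_one_three_eq (c :: B)) (by simp [coeff_zero_eq_eval_zero, cyc])
    (by simp [coeff_zero_eq_eval_zero, cyc]) (by omega) (by simpa using hB) (by simp)

/-- The valuation of `numer a [c₁, c₂, c₃, c₄, …]` for `c₁ ≤ c₂ ≤ …`; missing entries are `0`. -/
def valOf (a c₁ c₂ c₃ c₄ : ℕ) : ℕ :=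
  if c₁ = 0 then a
  else if a ≠ c₁ then min a c₁
  else if c₂ = 0 then a + 1
  else if c₂ = a then a
  else if a + 2 ≤ c₂ then a + 1
  else if c₃ = a + 1 then a + 1
  else if 3 ≤ a then (if c₃ = 0 then a + 3 else min c₃ (a + 3))
  else if a = 2 then (if c₃ = 0 then 6 else min c₃ 6)
  else if c₃ = 0 ∨ 4 ≤ c₃ ∨ c₄ = 3 then 3
  else if c₄ = 0 then 6 else min c₄ 6

/-- The branches of `valOf` follow the successive cancellations: `a` against c₁, `a + 1` against c₂,
then `a + 3`, 6 or 3 against c₃ according as a ≥ 3, a = 2 or a = 1, and for a = 1 finally 6 against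
c₄. -/
theorem hasVal_numer (ha : 1 ≤ a) (hB : ∀ c ∈ B, 1 ≤ c) (hs : B.Pairwise (· ≤ ·)) :
    HasVal (numer a B) (valOf a (B.getD 0 0) (B.getD 1 0) (B.getD 2 0) (B.getD 3 0)) := by
  rcases B with _ | ⟨c₁, B⟩
  · exact hasVal_numer_nil ha
  have h₁ : c₁ ≠ 0 := by have := hB c₁ (by simp); omega
  rw [List.pairwise_cons] at hs
  obtain ⟨hs₁, hs⟩ := hs
  simp only [List.getD_cons_zero, List.getD_cons_succ, valOf, if_neg h₁]
  split_ifs with hne hn₂ he₂ hl₂ he₃ ha₃ hn₃ ha₂ hn₃ h3 hn₄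
  · exact hasVal_numer_ne ha (by omega) (by simpa using hs₁) hne
  all_goals
    obtain rfl : a = c₁ := not_not.1 hne
    rcases B with _ | ⟨c₂, B⟩
    · first
        | exact hasVal_numer_single ha
        | exact absurd rfl hn₂
    rw [List.pairwise_cons] at hs
    obtain ⟨hs₂, hs⟩ := hs
    have h₂ := hs₁ c₂ (by simp)
    simp only [List.getD_cons_zero, List.getD_cons_succ] at *
  · omega
  · subst he₂
    exact hasVal_numer_eq_eq ha hs₂
  · exact hasVal_numer_eq_lt ha hs₂ hl₂
  all_goals
    obtain rfl : c₂ = a + 1 := by omega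
    rcases B with _ | ⟨c₃, B⟩
    · first
        | exact hasVal_numer_pair ha₃
        | (subst ha₂; exact hasVal_numer_two)
        | (obtain rfl : a = 1 := by omega
           exact hasVal_numer_one)
        | simp_all
    rw [List.pairwise_cons] at hs
    obtain ⟨hs₃, hs⟩ := hs
    have h₃ := hs₂ c₃ (by simp)
    simp only [List.getD_cons_zero, List.getD_cons_succ] at *
  · subst he₃
    exact hasVal_numer_succ_succ ha hs₃
  · omega
  · exact hasVal_numer_pair_cons ha₃ (by omega) hs₃
  · omega
  · subst ha₂
    exact hasVal_numer_two_cons (by omega) hs₃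
  all_goals
    obtain rfl : a = 1 := by omega
    rcases B with _ | ⟨c₄, B⟩
    · first
        | exact absurd rfl hn₄
        | (obtain rfl : c₃ = 3 := by simp only [List.getD_nil] at *; omega
           exact hasVal_numer_one_three)
        | (simp only [List.getD_nil] at *; exact hasVal_numer_one_lt (by omega) hs₃)
    rw [List.pairwise_cons] at hs
    obtain ⟨hs₄, hs⟩ := hs
    have h₄ := hs₃ c₄ (by simp)
    simp only [List.getD_cons_zero] at *
  · by_cases h4 : 4 ≤ c₃
    · exact hasVal_numer_one_lt h4 hs₃
    · obtain rfl : c₃ = 3 := by omega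
      obtain rfl : c₄ = 3 := by omega
      exact hasVal_numer_one_three_three hs₄
  · omega
  · obtain rfl : c₃ = 3 := by omega
    exact hasVal_numer_one_three_cons (by omega) hs₄

end Valuations

/-! ### The lowest exponent in terms of the numbers of entries of each kind -/

/-- The number of entries of a list which satisfy `p`. -/
def tally (p : ℤ → Prop) [DecidablePred p] (L : List ℤ) : ℤ :=
  (L.map fun x => if p x then (1 : ℤ) else 0).sum

/-- The sum of the entries `> 1`. -/
def posSum (L : List ℤ) : ℤ := (L.map fun x => if 1 < x then x else 0).sum

/-- The sum of the absolute values of the entries `< -1`. -/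
def negSum (L : List ℤ) : ℤ := (L.map fun x => if x < -1 then -x else 0).sum

section Tally

variable {p : ℤ → Prop} [DecidablePred p]

theorem tally_cons (x : ℤ) (L : List ℤ) :
    tally p (x :: L) = (if p x then 1 else 0) + tally p L := by simp [tally]

theorem tally_nonneg (L : List ℤ) : 0 ≤ tally p L := by
  induction L with
  | nil => simp [tally]
  | cons x L ih => rw [tally_cons]; split_ifs <;> omega

theorem tally_eq_zero {L : List ℤ} : tally p L = 0 ↔ ∀ x ∈ L, ¬ p x := by
  induction L with
  | nil => simp [tally]
  | cons x L ih =>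
    have := tally_nonneg (p := p) L
    rw [tally_cons, List.forall_mem_cons, ← ih]
    split_ifs with h <;> simp [h]
    omega

theorem posSum_cons (x : ℤ) (L : List ℤ) :
    posSum (x :: L) = (if 1 < x then x else 0) + posSum L := by simp [posSum]

theorem negSum_cons (x : ℤ) (L : List ℤ) :
    negSum (x :: L) = (if x < -1 then -x else 0) + negSum L := by simp [negSum]

/-- For the ratios of the first product a bound is enough: entries 1, 0 and -2 only lower the sum
further. -/
theorem sum_low (L : List ℤ) :
    (L.map lowFst).sum =
      -negSum L - tally (1 < ·) L - tally (· = 1) L - tally (· = 0) L ∧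
    (L.map lowSnd).sum = -negSum L - tally (· = -1) L ∧
    (L.map ratioFst).sum ≤ -tally (1 < ·) L - tally (· = -1) L ∧
    (L.map ratioSnd).sum = -tally (· = 1) L - tally (· = -1) L ∧
    (L.length : ℤ) = tally (1 < ·) L + tally (· < -1) L + tally (· = 0) L + tally (· = 1) L +
      tally (· = -1) L := by
  induction L with
  | nil => simp [negSum, tally]
  | cons x L ih =>
    obtain ⟨h1, h2, h3, h4, h5⟩ := ih
    simp only [List.map_cons, List.sum_cons, tally_cons, negSum_cons, List.length_cons, h1, h2, h4,
      lowFst, lowSnd, ratioFst, ratioSnd]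
    push_cast
    rw [h5]
    refine ⟨?_, ?_, ?_, ?_, ?_⟩
    · split_ifs <;> omega
    · split_ifs <;> omega
    · split_ifs <;> omega
    · split_ifs <;> omega
    · split_ifs <;> omega

theorem tally_neg (L : List ℤ) :
    tally (1 < ·) (L.map Neg.neg) = tally (· < -1) L ∧
    tally (· < -1) (L.map Neg.neg) = tally (1 < ·) L ∧
    tally (· = 0) (L.map Neg.neg) = tally (· = 0) L ∧
    tally (· = 1) (L.map Neg.neg) = tally (· = -1) L ∧
    tally (· = -1) (L.map Neg.neg) = tally (· = 1) L ∧
    negSum (L.map Neg.neg) = posSum L := by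
  induction L with
  | nil => simp [negSum, posSum, tally]
  | cons x L ih =>
    obtain ⟨h1, h2, h3, h4, h5, h6⟩ := ih
    simp only [List.map_cons, tally_cons, negSum_cons, posSum_cons, h1, h2, h3, h4, h5, h6]
    refine ⟨?_, ?_, ?_, ?_, ?_, ?_⟩
    all_goals split_ifs <;> omega

/-- The lowest exponent, away from the cases of cancellation. -/
theorem lowDeg_generic {L : List ℤ} (hz : tally (· = 0) L = 0)
    (h : tally (1 < ·) L + tally (· = 1) L ≠ 1 + tally (· = -1) L) :
    LowDeg L (-negSum L - max (tally (1 < ·) L + tally (· = 1) L) (1 + tally (· = -1) L)) := by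
  obtain ⟨h1, h2, -⟩ := sum_low L
  have := lowDeg_of_ne (L := L) (fun h0 => tally_eq_zero.1 hz 0 h0 rfl) (by omega)
  convert this using 1
  omega

theorem lowDeg_zero {L : List ℤ} (hz : tally (· = 0) L ≠ 0) :
    LowDeg L (-negSum L - tally (1 < ·) L - tally (· = 1) L - tally (· = 0) L) := by
  rw [← (sum_low L).1]
  refine lowDeg_of_zero_mem ?_
  by_contra h0
  exact hz (tally_eq_zero.2 fun x hx hx0 => h0 (hx0 ▸ hx))

/-- The ratios of the first product sum to at most -r - β, those of the second summand to -1 - β;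
they differ as r > 1. -/
theorem lowDeg_cancel {L : List ℤ} (hz : tally (· = 0) L = 0) (hr : 1 < tally (1 < ·) L)
    (ha : tally (· = 1) L = 0) (hb : tally (· = -1) L = tally (1 < ·) L - 1) :
    LowDeg L (-negSum L - tally (1 < ·) L + 1) := by
  obtain ⟨h1, h2, h3, h4, -⟩ := sum_low L
  have := lowDeg_of_eq (L := L) (fun h0 => tally_eq_zero.1 hz 0 h0 rfl) (by omega) (by omega)
  convert this using 1
  omega

end Tally

theorem exists_onePos {L : List ℤ} (hL : L.Pairwise (· ≥ ·))
    (h : tally (1 < ·) L + tally (· = 1) L = 1) (hz : tally (· = 0) L = 0)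
    (hb : tally (· = -1) L = 0) :
    ∃ (a : ℕ) (B : List ℕ), L = onePos a B ∧ 1 ≤ a ∧ (∀ c ∈ B, 1 ≤ c) ∧ B.Pairwise (· ≤ ·) := by
  rcases L with _ | ⟨x, T⟩
  · simp [tally] at h
  have hx : 1 ≤ x := by
    by_contra hx
    rw [List.pairwise_cons] at hL
    have hall : ∀ y ∈ x :: T, y ≤ 0 := by
      intro y hy
      rcases List.mem_cons.1 hy with rfl | hy
      · omega
      · have := hL.1 y hy; omega
    rw [tally_eq_zero.2 fun y hy => by have := hall y hy; omega,
      tally_eq_zero.2 fun y hy => by have := hall y hy; omega] at h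
    omega
  have n1 := tally_nonneg (p := (1 < ·)) T
  have n2 := tally_nonneg (p := (· = 1)) T
  have hT : tally (1 < ·) T = 0 ∧ tally (· = 1) T = 0 := by
    simp only [tally_cons] at h
    split_ifs at h <;> omega
  have hT' : ∀ y ∈ T, y ≤ -2 := by
    intro y hy
    have e1 := tally_eq_zero.1 hT.1 y hy
    have e2 := tally_eq_zero.1 hT.2 y hy
    have e3 := tally_eq_zero.1 hz y (by simp [hy])
    have e4 := tally_eq_zero.1 hb y (by simp [hy])
    omega
  refine ⟨x.toNat, T.map fun y => (-y - 1).toNat, ?_, by omega, ?_, ?_⟩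
  · rw [onePos, List.map_map]
    congr 1
    · omega
    · conv_lhs => rw [← List.map_id T]
      refine List.map_congr_left fun y hy => ?_
      have := hT' y hy
      simp only [id, Function.comp_apply]
      omega
  · intro c hc
    obtain ⟨y, hy, rfl⟩ := List.mem_map.1 hc
    have := hT' y hy
    omega
  · rw [List.pairwise_cons] at hL
    refine List.Pairwise.map _ (fun y y' hyy => ?_) hL.2
    omega

theorem lowDeg_onePos_valOf {a : ℕ} {B : List ℕ} (ha : 1 ≤ a) (hB : ∀ c ∈ B, 1 ≤ c)
    (hs : B.Pairwise (· ≤ ·)) :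
    LowDeg (onePos a B) (-1 + (B.map fun c : ℕ => -((c : ℤ) + 1)).sum +
      valOf a (B.getD 0 0) (B.getD 1 0) (B.getD 2 0) (B.getD 3 0)) :=
  lowDeg_onePos (hasVal_numer ha hB hs)

end Pretzel

/-! ### From tuples to lists, and the span from two lowest exponents -/

namespace Pretzel

open LinkDiagram

variable {n : ℕ}

theorem tally_ofFn (p : ℤ → Prop) [DecidablePred p] (a : Fin n → ℤ) :
    ((Finset.univ.filter fun i => p (a i)).card : ℤ) = tally p (List.ofFn a) := by
  rw [tally, List.map_ofFn, List.sum_ofFn, Finset.natCast_card_filter]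
  rfl

theorem sigma_eq (a : Fin n → ℤ) :
    sigma a = posSum (List.ofFn a) + negSum (List.ofFn a) := by
  rw [sigma, posSum, negSum, List.map_ofFn, List.map_ofFn, List.sum_ofFn, List.sum_ofFn,
    Finset.sum_filter, ← Finset.sum_add_distrib]
  refine Finset.sum_congr rfl fun i _ => ?_
  simp only [Function.comp_apply]
  rcases abs_cases (a i) with h | h <;> rw [h.1] <;> split_ifs <;> omega

theorem entry_eq (a : Fin n → ℤ) (k : ℕ) : entry a k = (List.ofFn a).getD (k - 1) 0 := by
  rw [entry]
  split_ifs with h <;> simp [List.getD_eq_getElem?_getD, h]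

/-- Negating the tuple replaces `q` by `q⁻¹`, so `w` is the order in `q⁻¹` of the polynomial of `a`.
Passing from `a` to `-a` exchanges `v` and `w`, and the span is symmetric in them. -/
theorem jones_span_of_lowDeg [NeZero n] {a c : Fin n → ℤ} {τ : Equiv.Perm (Fin n)}
    (hc : c = a ∘ τ ∨ c = -(a ∘ τ)) (o : (diagram c).Orientation) {v w : ℤ}
    (hv : LowDeg (List.ofFn a) v) (hw : LowDeg ((List.ofFn a).map Neg.neg) w) :
    (diagram c).jones o ≠ 0 ∧ tSpan ((diagram c).jones o) = ((-v - w - n : ℤ) : ℚ) := by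
  have hp : (List.ofFn (a ∘ τ)).Perm (List.ofFn a) := τ.ofFn_comp_perm a
  have h1 := hv unitQ
  have h2 := hv unitQ⁻¹
  have h3 := hw unitQ
  have h4 := hw unitQ⁻¹
  rw [pretzelPoly_neg] at h3 h4
  rw [inv_inv] at h4
  rcases hc with rfl | rfl
  · rw [← pretzelPoly_perm _ hp] at h1 h4
    exact jones_ne_zero_and_tSpan _ o h1 h4
  · have e : List.ofFn (-(a ∘ τ)) = (List.ofFn (a ∘ τ)).map Neg.neg := by
      rw [List.map_ofFn]; rfl
    rw [← pretzelPoly_perm _ hp, ← pretzelPoly_neg, ← e] at h3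
    rw [← pretzelPoly_perm _ hp, ← pretzelPoly_neg, ← e] at h2
    have := jones_ne_zero_and_tSpan _ o h3 h2
    rwa [show -w - v - (n : ℤ) = -v - w - n by ring] at this

theorem sum_onePos (a : ℕ) {B : List ℕ} (hB : ∀ c ∈ B, 1 ≤ c) :
    posSum (onePos a B) = (if 1 < (a : ℤ) then (a : ℤ) else 0) ∧
    (B.map fun c : ℕ => -((c : ℤ) + 1)).sum = -negSum (onePos a B) := by
  have key : posSum (B.map fun c : ℕ => -((c : ℤ) + 1)) = 0 ∧
      (B.map fun c : ℕ => -((c : ℤ) + 1)).sum =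
        -negSum (B.map fun c : ℕ => -((c : ℤ) + 1)) := by
    induction B with
    | nil => simp [posSum, negSum]
    | cons c B ih =>
      obtain ⟨h1, h2⟩ := ih fun x hx => hB x (by simp [hx])
      have := hB c (by simp)
      simp only [List.map_cons, posSum_cons, negSum_cons, List.sum_cons, h1, h2]
      constructor <;> split_ifs <;> omega
  rw [onePos, posSum_cons, negSum_cons, key.1, key.2]
  constructor <;> split_ifs <;> omega

theorem tally_of_isOneNegOne {a : Fin n → ℤ} (h : IsOneNegOne a) :
    tally (1 < ·) (List.ofFn a) = 0 ∧ tally (· < -1) (List.ofFn a) = 0 ∧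
    tally (· = 0) (List.ofFn a) = 0 ∧ tally (· = 1) (List.ofFn a) = 1 ∧
    tally (· = -1) (List.ofFn a) = 1 ∧ posSum (List.ofFn a) = 0 ∧ negSum (List.ofFn a) = 0 := by
  obtain ⟨rfl, h1, h2⟩ := h
  have h1 : a 0 = 1 := h1
  have h2 : a 1 = -1 := h2
  simp [List.ofFn_succ, tally, posSum, negSum, h1, h2]

end Pretzel

/-! ### Small tuples whose negative also cancels -/

namespace Pretzel

theorem exists_triple {L : List ℤ} (hL : L.Pairwise (· ≥ ·)) (hr : tally (1 < ·) L = 2)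
    (hs : tally (· < -1) L = 0) (hz : tally (· = 0) L = 0) (ha : tally (· = 1) L = 0)
    (hb : tally (· = -1) L = 1) :
    ∃ x y : ℕ, L = [(x : ℤ), (y : ℤ), -1] ∧ 2 ≤ y ∧ y ≤ x := by
  have hlen := (sum_low L).2.2.2.2
  have hlen : L.length = 3 := by omega
  obtain ⟨x, y, t, rfl⟩ := List.length_eq_three.1 hlen
  simp only [tally, List.map_cons, List.map_nil, List.sum_cons, List.sum_nil] at hr hb
  simp only [List.pairwise_cons, List.mem_cons, forall_eq_or_imp] at hL
  obtain ⟨⟨hxy, hxt, -⟩, ⟨hyt, -⟩, -⟩ := hL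
  have ht : t = -1 := by omega
  exact ⟨x.toNat, y.toNat, by rw [ht, Int.toNat_of_nonneg, Int.toNat_of_nonneg] <;> omega,
    by omega, by omega⟩

/-- The negated triple has the single positive entry 1, so it falls under the analysis of `numer`.
-/
theorem lowDeg_neg_triple {x y : ℕ} (hy : 2 ≤ y) (hxy : y ≤ x) :
    LowDeg ([(x : ℤ), (y : ℤ), -1].map Neg.neg)
      (-1 - x - y + valOf 1 (y - 1) (x - 1) 0 0) := by
  have h := lowDeg_onePos_valOf (a := 1) (B := [y - 1, x - 1]) le_rfl
    (by simp; omega) (by simp; omega)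
  have hp : (onePos 1 [y - 1, x - 1]).Perm ([(x : ℤ), (y : ℤ), -1].map Neg.neg) := by
    have e : onePos 1 [y - 1, x - 1] = [-(-1), -(y : ℤ), -(x : ℤ)] := by
      simp only [onePos, List.map_cons, List.map_nil, List.cons.injEq, and_true]
      omega
    rw [e, List.map_cons, List.map_cons, List.map_cons, List.map_nil]
    exact (List.Perm.swap _ _ _).trans
      (((List.Perm.swap _ _ _).cons _).trans (List.Perm.swap _ _ _))
  have h' := h.perm hp
  convert h' using 1
  simp
  omega

theorem lowDeg_neg_pair {x c : ℕ} (hx : 2 ≤ x) (hc : 1 ≤ c) :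
    LowDeg ((onePos x [c]).map Neg.neg) (-1 - x + valOf (c + 1) (x - 1) 0 0 0) := by
  have h := lowDeg_onePos_valOf (a := c + 1) (B := [x - 1]) (by omega)
    (by simp; omega) (by simp)
  have hp : (onePos (c + 1) [x - 1]).Perm ((onePos x [c]).map Neg.neg) := by
    have e : onePos (c + 1) [x - 1] = [-(-((c : ℤ) + 1)), -(x : ℤ)] := by
      simp only [onePos, List.map_cons, List.map_nil, List.cons.injEq, and_true]
      omega
    rw [e, onePos, List.map_cons, List.map_cons, List.map_cons, List.map_nil, List.map_nil]
    exact List.Perm.swap _ _ _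
  have h' := h.perm hp
  convert h' using 1
  simp
  omega

/-- As the entries of `B` are positive, the default value `0` marks a missing entry. This turns `B`
into linear data for `omega`; the sum is needed only for at most three entries. -/
theorem getD_cases {B : List ℕ} (hB : ∀ c ∈ B, 1 ≤ c) (hs : B.Pairwise (· ≤ ·)) {N : ℤ}
    (hN : N = -(B.map fun c : ℕ => -((c : ℤ) + 1)).sum) {l : ℤ} (hl : l = B.length)
    {c₁ c₂ c₃ c₄ : ℕ} (h₁ : c₁ = B.getD 0 0) (h₂ : c₂ = B.getD 1 0) (h₃ : c₃ = B.getD 2 0)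
    (h₄ : c₄ = B.getD 3 0) :
    (l = 0 ∧ c₁ = 0 ∧ c₂ = 0 ∧ c₃ = 0 ∧ c₄ = 0 ∧ N = 0) ∨
    (l = 1 ∧ c₁ ≠ 0 ∧ c₂ = 0 ∧ c₃ = 0 ∧ c₄ = 0 ∧ N = c₁ + 1) ∨
    (l = 2 ∧ c₁ ≠ 0 ∧ c₂ ≠ 0 ∧ c₃ = 0 ∧ c₄ = 0 ∧ c₁ ≤ c₂ ∧ N = c₁ + c₂ + 2) ∨
    (l = 3 ∧ c₁ ≠ 0 ∧ c₂ ≠ 0 ∧ c₃ ≠ 0 ∧ c₄ = 0 ∧ c₁ ≤ c₂ ∧ c₂ ≤ c₃ ∧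
      N = c₁ + c₂ + c₃ + 3) ∨
    (4 ≤ l ∧ c₁ ≠ 0 ∧ c₂ ≠ 0 ∧ c₃ ≠ 0 ∧ c₄ ≠ 0 ∧ c₁ ≤ c₂ ∧ c₂ ≤ c₃ ∧ c₃ ≤ c₄) := by
  subst h₁ h₂ h₃ h₄ hN hl
  rcases B with _ | ⟨c₁, _ | ⟨c₂, _ | ⟨c₃, _ | ⟨c₄, B⟩⟩⟩⟩ <;>
    (try simp only [List.pairwise_cons, List.mem_cons, forall_eq_or_imp] at hB hs)
  · exact Or.inl ⟨rfl, rfl, rfl, rfl, rfl, rfl⟩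
  · refine Or.inr (Or.inl ⟨?_, ?_, ?_, ?_, ?_, ?_⟩)
    all_goals first | (simp; done) | (simp; omega)
  · refine Or.inr (Or.inr (Or.inl ⟨?_, ?_, ?_, ?_, ?_, ?_, ?_⟩))
    all_goals first | (simp; done) | (simp; omega)
  · refine Or.inr (Or.inr (Or.inr (Or.inl ⟨?_, ?_, ?_, ?_, ?_, ?_, ?_, ?_⟩)))
    all_goals first | (simp; done) | (simp; omega)
  · refine Or.inr (Or.inr (Or.inr (Or.inr ⟨?_, ?_, ?_, ?_, ?_, ?_, ?_, ?_⟩)))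
    all_goals first | (simp; done) | (simp; omega)

theorem getD_onePos {B : List ℕ} (hB : ∀ c ∈ B, 1 ≤ c) (a k : ℕ) :
    (onePos a B).getD (k + 1) 0 =
      if B.getD k 0 = 0 then 0 else -((B.getD k 0 : ℤ) + 1) := by
  rw [onePos, List.getD_cons_succ]
  by_cases hk : k < B.length
  · have := hB _ (List.getElem_mem hk)
    simp only [List.getD_eq_getElem?_getD, List.getElem?_map, List.getElem?_eq_getElem hk,
      Option.map_some, Option.getD_some]
    rw [if_neg (by omega)]
  · simp [List.getD_eq_getElem?_getD, List.getElem?_eq_none (not_lt.1 hk)]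

end Pretzel

/-! ### Reading off the spans -/

namespace Pretzel

theorem valOf_triple {x y : ℕ} (hy : 2 ≤ y) (hxy : y ≤ x) :
    (2 < y → valOf 1 (y - 1) (x - 1) 0 0 = 1) ∧
    (y = 2 → x = 2 → valOf 1 (y - 1) (x - 1) 0 0 = 1) ∧
    (y = 2 → x = 3 → valOf 1 (y - 1) (x - 1) 0 0 = 3) ∧
    (y = 2 → 3 < x → valOf 1 (y - 1) (x - 1) 0 0 = 2) := by
  refine ⟨fun h => ?_, ?_, ?_, ?_⟩
  · rw [valOf, if_neg (by omega), if_pos (by omega)]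
    omega
  · rintro rfl rfl
    rfl
  · rintro rfl rfl
    rfl
  · rintro rfl h
    rw [valOf, if_neg (by omega), if_neg (by omega), if_neg (by omega), if_neg (by omega),
      if_pos (by omega)]

/-- The span for `r = 1`, `λ = 0`, `s = 1`. -/
theorem span_of_pair {A c : ℕ} {S : ℤ} (hA : 2 ≤ A) (hc : c ≠ 0)
    (hS : S = A + c + 1 - valOf A c 0 0 0 - valOf (c + 1) (A - 1) 0 0 0) :
    (|(A : ℤ) + -(c + 1)| = 0 → S = 2) ∧ (|(A : ℤ) + -(c + 1)| = 1 → S = 1) ∧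
    (1 < |(A : ℤ) + -(c + 1)| → S = 1 + |(A : ℤ) + -(c + 1)|) := by
  have h (a b : ℕ) (hb : b ≠ 0) : valOf a b 0 0 0 = if a ≠ b then min a b else a + 1 := by
    rw [valOf, if_neg hb, if_pos rfl]
  rw [h _ _ hc, h _ _ (by omega)] at hS
  rw [show |(A : ℤ) + -(c + 1)| = max (A + -(c + 1) : ℤ) (-(A + -(c + 1) : ℤ)) from rfl]
  split_ifs at hS <;> omega

/-- The span for `r = 1`, `λ = 0`, `s ≥ 2`. -/
theorem span_of_one_lt {A c₁ c₂ c₃ c₄ : ℕ} {s Sg S a₁ a₂ a₃ a₄ : ℤ}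
    (hS : S = Sg - valOf A c₁ c₂ c₃ c₄) (hA : 2 ≤ A) (hc : c₁ ≠ 0 ∧ c₂ ≠ 0 ∧ c₁ ≤ c₂)
    (hc₃ : c₃ = 0 ∧ a₄ = 0 ∧ s = 2 ∧ Sg = A + c₁ + c₂ + 2 ∨
      c₃ ≠ 0 ∧ c₂ ≤ c₃ ∧ a₄ = -((c₃ : ℤ) + 1) ∧ 3 ≤ s)
    (h₁ : a₁ = A) (h₂ : a₂ = -((c₁ : ℤ) + 1)) (h₃ : a₃ = -((c₂ : ℤ) + 1)) :
    (a₁ ≠ -a₂ - 1 → S = Sg - min a₁ (-a₂ - 1)) ∧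
    (a₁ = -a₂ - 1 → -a₂ ≠ -a₃ - 1 → S = Sg - min (-a₂) (-a₃ - 1)) ∧
    (s = 2 → a₁ = -a₂ - 1 → -a₂ = -a₃ - 1 →
      (¬ (a₁ = 2 ∧ a₂ = -3 ∧ a₃ = -4) → S = 2 * a₁) ∧
      (a₁ = 2 ∧ a₂ = -3 ∧ a₃ = -4 → S = 3)) ∧
    (3 ≤ s → a₁ = -a₂ - 1 → -a₂ = -a₃ - 1 →
      (-a₃ < -a₄ - 1 →
        (¬ (a₁ = 2 ∧ a₂ = -3 ∧ a₃ = -4 ∧ a₄ < -6) → S = Sg - a₁ - 3) ∧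
        (a₁ = 2 ∧ a₂ = -3 ∧ a₃ = -4 ∧ a₄ < -6 → S = Sg - 6)) ∧
      (-a₃ = -a₄ - 1 → S = Sg - a₁ - 2) ∧
      (-a₃ = -a₄ → S = Sg - a₁ - 1)) := by
  obtain ⟨hc1, hc2, hc3⟩ := hc
  subst h₁ h₂ h₃
  unfold valOf at hS
  rw [if_neg hc1, if_neg hc2] at hS
  rcases hc₃ with ⟨e1, e2, e3, e4⟩ | ⟨e1, e2, e3, e4⟩
  · subst e2
    rw [if_pos e1, if_pos e1, if_pos (Or.inl e1)] at hS
    split_ifs at hS <;> subst hS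
    all_goals
      repeat' first | intro _ | apply And.intro
    all_goals omega
  · subst e3
    rw [if_neg e1, if_neg e1] at hS
    split_ifs at hS <;> subst hS
    all_goals
      repeat' first | intro _ | apply And.intro
    all_goals omega

set_option maxHeartbeats 1000000 in
/-- The span for `r = 0`, `λ = 1`. -/
theorem span_of_eq_one {c₁ c₂ c₃ c₄ : ℕ} {s Sg S a₂ a₃ a₄ a₅ : ℤ}
    (hS : S = Sg - valOf 1 c₁ c₂ c₃ c₄ + (if s = 2 then -1 else max s 2 - s))
    (hc : (s = 0 ∧ c₁ = 0 ∧ c₂ = 0 ∧ c₃ = 0 ∧ c₄ = 0 ∧ Sg = 0) ∨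
      (s = 1 ∧ c₁ ≠ 0 ∧ c₂ = 0 ∧ c₃ = 0 ∧ c₄ = 0 ∧ Sg = c₁ + 1) ∨
      (s = 2 ∧ c₁ ≠ 0 ∧ c₂ ≠ 0 ∧ c₃ = 0 ∧ c₄ = 0 ∧ c₁ ≤ c₂ ∧ Sg = c₁ + c₂ + 2) ∨
      (s = 3 ∧ c₁ ≠ 0 ∧ c₂ ≠ 0 ∧ c₃ ≠ 0 ∧ c₄ = 0 ∧ c₁ ≤ c₂ ∧ c₂ ≤ c₃ ∧
        Sg = c₁ + c₂ + c₃ + 3) ∨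
      (4 ≤ s ∧ c₁ ≠ 0 ∧ c₂ ≠ 0 ∧ c₃ ≠ 0 ∧ c₄ ≠ 0 ∧ c₁ ≤ c₂ ∧ c₂ ≤ c₃ ∧ c₃ ≤ c₄))
    (h₂ : a₂ = if c₁ = 0 then 0 else -((c₁ : ℤ) + 1))
    (h₃ : a₃ = if c₂ = 0 then 0 else -((c₂ : ℤ) + 1))
    (h₄ : a₄ = if c₃ = 0 then 0 else -((c₃ : ℤ) + 1))
    (h₅ : a₅ = if c₄ = 0 then 0 else -((c₄ : ℤ) + 1)) :
    (a₂ ≠ -2 →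
      (s = 0 → S = Sg + 1 ∧ S = 1) ∧
      (s = 1 → S = Sg ∧ S = -a₂) ∧
      (s = 2 → S = Sg - 2) ∧
      (2 < s → S = Sg - 1)) ∧
    (a₂ = -2 →
      (s = 1 → S = Sg - 1 ∧ S = 1) ∧
      (s = 2 → a₃ = -2 → S = Sg - 2 ∧ S = 2) ∧
      (s = 2 → a₃ = -3 → S = Sg - 4 ∧ S = 1) ∧
      (s = 2 → a₃ < -3 → S = Sg - 3 ∧ S = -1 - a₃) ∧
      (s = 3 → a₃ = -2 → S = Sg - 1 ∧ S = 3 - a₄) ∧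
      (s = 3 → a₃ = -3 → a₄ = -3 → S = Sg - 2 ∧ S = 6) ∧
      (s = 3 → a₃ = -3 → a₄ = -4 → S = Sg - 6 ∧ S = 3) ∧
      (s = 3 → a₃ = -3 → a₄ < -4 → S = Sg - 3 ∧ S = 2 - a₄) ∧
      (s = 3 → a₃ < -3 → S = Sg - 2 ∧ S = -a₃ - a₄) ∧
      (3 < s → a₃ = -2 → S = Sg - 1) ∧
      (3 < s → a₃ = -3 → a₄ = -3 → S = Sg - 2) ∧
      (3 < s → a₃ = -3 → a₄ = -4 → a₅ = -4 → S = Sg - 3) ∧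
      (3 < s → a₃ = -3 → a₄ = -4 → a₅ = -5 → S = Sg - 4) ∧
      (3 < s → a₃ = -3 → a₄ = -4 → a₅ < -5 →
        (¬ a₅ < -6 → S = Sg - 5) ∧ (a₅ < -6 → S = Sg - 6)) ∧
      (3 < s → a₃ = -3 → a₄ < -4 → S = Sg - 3) ∧
      (3 < s → a₃ < -3 → S = Sg - 2)) := by
  have hm : (if s = 2 then (-1 : ℤ) else max s 2 - s) = -1 ∧ s = 2 ∨
      (if s = 2 then (-1 : ℤ) else max s 2 - s) = max s 2 - s ∧ s ≠ 2 := by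
    by_cases h : s = 2 <;> simp [h]
  generalize (if s = 2 then (-1 : ℤ) else max s 2 - s) = e at hS hm
  unfold valOf at hS
  rcases hc with ⟨e0, e1, e2, e3, e4, hc⟩ | ⟨e0, e1, e2, e3, e4, hc⟩ |
    ⟨e0, e1, e2, e3, e4, hc⟩ | ⟨e0, e1, e2, e3, e4, hc⟩ | ⟨e0, e1, e2, e3, e4, hc⟩ <;>
    simp only [e1, e2, e3, e4, if_true, if_false, false_or, or_false,
      Nat.reduceAdd, Nat.reduceLeDiff, Nat.reduceEqDiff] at h₂ h₃ h₄ h₅ hS <;>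
    (try split_ifs at hS)
  all_goals
    repeat' first | intro _ | apply And.intro
  all_goals omega

end Pretzel

/-! ### The case distinction -/

set_option maxHeartbeats 4000000 in
theorem theorem3p3 {n : ℕ} [NeZero n]
    -- a reduced tuple `a₁ ≥ … ≥ aₙ`
    (a : Fin n → ℤ) (hred : Pretzel.IsReduced a) (hanti : Antitone a)
    -- a link with diagram `P(c)`, where `c` is a rearrangement of `a` or of `-a`, oriented by `o`
    (c : Fin n → ℤ) (τ : Equiv.Perm (Fin n)) (hc : c = a ∘ τ ∨ c = -(a ∘ τ))
    (o : (Pretzel.diagram c).Orientation)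
    -- its Jones polynomial
    (V : AddMonoidAlgebra ℤ ℚ) (hV : V = (Pretzel.diagram c).jones o)
    -- the parameters `r`, `s`, `z`, `λ`, `Σ` of `a` and the first entries
    (r s z lam Sg a₁ a₂ a₃ a₄ a₅ : ℤ)
    (hr : r = Pretzel.r a) (hs : s = Pretzel.s a) (hz : z = Pretzel.z a)
    (hlam : lam = Pretzel.lam a) (hSg : Sg = Pretzel.sigma a)
    (h₁ : a₁ = Pretzel.entry a 1) (h₂ : a₂ = Pretzel.entry a 2) (h₃ : a₃ = Pretzel.entry a 3)
    (h₄ : a₄ = Pretzel.entry a 4) (h₅ : a₅ = Pretzel.entry a 5) :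
    V ≠ 0 ∧
    ∃ S : ℤ, tSpan V = (S : ℚ) ∧
    -- some entry is zero
    (0 < z → S = Sg + z) ∧
    (z = 0 →
      -- the generic case
      (r + lam ≠ 1 → s - lam ≠ 1 →
        (¬ Pretzel.IsOneNegOne a → S = Sg - min 1 (min (r + lam) (s - lam)) + 1) ∧
        (Pretzel.IsOneNegOne a → S = 2)) ∧
      (r + lam = 1 →
        -- at least two entries greater than one
        (1 < r →
          ((r, lam, s) ≠ (2, -1, 0) → S = Sg - 1) ∧
          ((r, lam, s) = (2, -1, 0) →
            (a₂ = 2 → a₁ = 2 → S = Sg - 2 ∧ S = 2) ∧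
            (a₂ = 2 → a₁ = 3 → S = Sg - 4 ∧ S = 1) ∧
            (a₂ = 2 → 3 < a₁ → S = Sg - 3 ∧ S = a₁ - 1) ∧
            (2 < a₂ → S = Sg - 2 ∧ S = a₁ + a₂ - 2))) ∧
        -- one entry greater than one, at most one less than minus one
        (r = 1 → s ≤ 1 →
          (s = 0 → S = 1 ∧ S = Sg - a₁ + 1) ∧
          (s = 1 → |a₁ + a₂| = 0 → S = 2) ∧
          (s = 1 → |a₁ + a₂| = 1 → S = 1) ∧
          (s = 1 → 1 < |a₁ + a₂| → S = 1 + |a₁ + a₂|)) ∧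
        -- one entry greater than one, at least two less than minus one
        (r = 1 → 1 < s →
          (a₁ ≠ |a₂| - 1 →
            S = Sg - min a₁ (|a₂| - 1)) ∧
          (a₁ = |a₂| - 1 → |a₂| ≠ |a₃| - 1 →
            S = Sg - min |a₂| (|a₃| - 1)) ∧
          (s = 2 → a₁ = |a₂| - 1 → |a₂| = |a₃| - 1 →
            (¬ (a₁ = 2 ∧ a₂ = -3 ∧ a₃ = -4) → S = 2 * a₁) ∧
            (a₁ = 2 ∧ a₂ = -3 ∧ a₃ = -4 → S = 3)) ∧
          (3 ≤ s → a₁ = |a₂| - 1 → |a₂| = |a₃| - 1 →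
            (|a₃| < |a₄| - 1 →
              (¬ (a₁ = 2 ∧ a₂ = -3 ∧ a₃ = -4 ∧ a₄ < -6) →
                S = Sg - a₁ - 3) ∧
              (a₁ = 2 ∧ a₂ = -3 ∧ a₃ = -4 ∧ a₄ < -6 →
                S = Sg - 6)) ∧
            (|a₃| = |a₄| - 1 → S = Sg - a₁ - 2) ∧
            (|a₃| = |a₄| → S = Sg - a₁ - 1))) ∧
        -- no entry greater than one, second entry not minus two
        (r = 0 → a₂ ≠ -2 →
          (s = 0 → S = Sg + 1 ∧ S = 1) ∧
          (s = 1 → S = Sg ∧ S = -a₂) ∧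
          (s = 2 → S = Sg - 2) ∧
          (2 < s → S = Sg - 1)) ∧
        -- no entry greater than one, second entry minus two
        (r = 0 → a₂ = -2 →
          (s = 1 → S = Sg - 1 ∧ S = 1) ∧
          (s = 2 → a₃ = -2 → S = Sg - 2 ∧ S = 2) ∧
          (s = 2 → a₃ = -3 → S = Sg - 4 ∧ S = 1) ∧
          (s = 2 → a₃ < -3 → S = Sg - 3 ∧ S = -1 - a₃) ∧
          (s = 3 → a₃ = -2 → S = Sg - 1 ∧ S = 3 - a₄) ∧
          (s = 3 → a₃ = -3 → a₄ = -3 → S = Sg - 2 ∧ S = 6) ∧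
          (s = 3 → a₃ = -3 → a₄ = -4 → S = Sg - 6 ∧ S = 3) ∧
          (s = 3 → a₃ = -3 → a₄ < -4 → S = Sg - 3 ∧ S = 2 - a₄) ∧
          (s = 3 → a₃ < -3 → S = Sg - 2 ∧ S = -a₃ - a₄) ∧
          (3 < s → a₃ = -2 → S = Sg - 1) ∧
          (3 < s → a₃ = -3 → a₄ = -3 → S = Sg - 2) ∧
          (3 < s → a₃ = -3 → a₄ = -4 → a₅ = -4 → S = Sg - 3) ∧
          (3 < s → a₃ = -3 → a₄ = -4 → a₅ = -5 → S = Sg - 4) ∧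
          (3 < s → a₃ = -3 → a₄ = -4 → a₅ < -5 →
            (¬ a₅ < -6 → S = Sg - 5) ∧ (a₅ < -6 → S = Sg - 6)) ∧
          (3 < s → a₃ = -3 → a₄ < -4 → S = Sg - 3) ∧
          (3 < s → a₃ < -3 → S = Sg - 2)))) := by
  set L := List.ofFn a with hL
  have hsort : L.Pairwise (· ≥ ·) := by
    rw [hL, List.pairwise_ofFn]
    exact fun i j hij => hanti hij.le
  -- Both exponents are fixed before the case distinction; in each case they are evaluated through
  -- uniqueness.
  obtain ⟨v, hv⟩ := Pretzel.exists_lowDeg L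
  obtain ⟨w, hw⟩ := Pretzel.exists_lowDeg (L.map Neg.neg)
  obtain ⟨hV0, hspan⟩ := Pretzel.jones_span_of_lowDeg hc o hv hw
  have hone := Pretzel.tally_of_isOneNegOne (a := a)
  have hlen := (Pretzel.sum_low L).2.2.2.2
  have hlen' : (L.length : ℤ) = n := by rw [hL, List.length_ofFn]
  have hn0 : 0 < n := Nat.pos_of_ne_zero (NeZero.ne n)
  rw [hlen'] at hlen
  obtain ⟨m1, m2, m3, m4, m5, m6⟩ := Pretzel.tally_neg L
  rw [Pretzel.sigma_eq, ← hL] at hSg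
  rw [Pretzel.r, Pretzel.tally_ofFn (1 < ·), ← hL] at hr
  rw [Pretzel.s, Pretzel.tally_ofFn (· < -1), ← hL] at hs
  have hred' : Pretzel.IsOneNegOne a ∨ ((Pretzel.tally (· = 1) L = 0 ∨
      Pretzel.tally (· = -1) L = 0) ∧ (z ≠ 0 → Pretzel.tally (· = 1) L = 0 ∧
      Pretzel.tally (· = -1) L = 0)) := by
    rw [Pretzel.IsReduced, Pretzel.alpha, Pretzel.beta, Pretzel.tally_ofFn (· = 1),
      Pretzel.tally_ofFn (· = -1), ← hL, ← hz, mul_eq_zero] at hred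
    exact hred
  rw [Pretzel.z, Pretzel.tally_ofFn (· = 0), ← hL] at hz
  rw [Pretzel.lam, Pretzel.alpha, Pretzel.beta, Pretzel.tally_ofFn (· = 1),
    Pretzel.tally_ofFn (· = -1), ← hL] at hlam
  rw [Pretzel.entry_eq, ← hL] at h₁ h₂ h₃ h₄ h₅
  simp only [← hL, ← hr, ← hs, ← hz] at hone
  have g0 : z ≠ 0 → v = -Pretzel.negSum L - r - Pretzel.tally (· = 1) L - z := fun h =>
    hv.unique (by rw [hr, hz]; exact Pretzel.lowDeg_zero (hz ▸ h))
  have g0' : z ≠ 0 → w = -Pretzel.posSum L - s - Pretzel.tally (· = -1) L - z := fun h => by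
    have := hw.unique (Pretzel.lowDeg_zero (by rw [m3]; exact hz ▸ h))
    rwa [m1, m3, m4, m6, ← hs, ← hz] at this
  have g1 : z = 0 → r + Pretzel.tally (· = 1) L ≠ 1 + Pretzel.tally (· = -1) L →
      v = -Pretzel.negSum L -
        max (r + Pretzel.tally (· = 1) L) (1 + Pretzel.tally (· = -1) L) := fun h h' => by
    rw [hr] at h' ⊢
    exact hv.unique (Pretzel.lowDeg_generic (hz ▸ h) h')
  have g1' : z = 0 → s + Pretzel.tally (· = -1) L ≠ 1 + Pretzel.tally (· = 1) L →
      w = -Pretzel.posSum L -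
        max (s + Pretzel.tally (· = -1) L) (1 + Pretzel.tally (· = 1) L) := fun h h' => by
    have := Pretzel.lowDeg_generic (L := L.map Neg.neg) (by rw [m3, ← hz, h])
      (by rw [m1, m4, m5, ← hs]; exact h')
    rw [m1, m4, m5, m6, ← hs] at this
    exact hw.unique this
  have g2 : z = 0 → 1 < r → Pretzel.tally (· = 1) L = 0 → Pretzel.tally (· = -1) L = r - 1 →
      v = -Pretzel.negSum L - r + 1 := fun h h1 h2 h3 => by
    rw [hr] at h1 h3 ⊢
    exact hv.unique (Pretzel.lowDeg_cancel (hz ▸ h) h1 h2 h3)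
  have g2' : z = 0 → 1 < s → Pretzel.tally (· = -1) L = 0 → Pretzel.tally (· = 1) L = s - 1 →
      w = -Pretzel.posSum L - s + 1 := fun h h1 h2 h3 => by
    have := Pretzel.lowDeg_cancel (L := L.map Neg.neg) (by rw [m3, ← hz, h])
      (by rw [m1, ← hs]; exact h1) (by rw [m4, h2]) (by rw [m1, m5, ← hs, h3])
    rw [m1, m6, ← hs] at this
    exact hw.unique this
  have hr0 := Pretzel.tally_nonneg (p := (1 < ·)) L
  have hs0 := Pretzel.tally_nonneg (p := (· < -1)) L
  have hz0 := Pretzel.tally_nonneg (p := (· = 0)) L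
  have hα0 := Pretzel.tally_nonneg (p := (· = 1)) L
  have hβ0 := Pretzel.tally_nonneg (p := (· = -1)) L
  rw [← hr] at hr0
  rw [← hs] at hs0
  rw [← hz] at hz0
  rw [← hr, ← hs, ← hz] at hlen
  have hexc : r + lam = 1 → z = 0 → 1 < r → r = 2 → lam = -1 → s = 0 →
      ∃ x y : ℕ, a₁ = x ∧ a₂ = y ∧ 2 ≤ y ∧ y ≤ x ∧ Pretzel.posSum L = x + y ∧
        Pretzel.negSum L = 0 ∧ w = -1 - x - y + Pretzel.valOf 1 (y - 1) (x - 1) 0 0 := by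
    intro e0 e1 e2 e3 e4 e5
    have hαβ := (hred'.resolve_left fun h => by have := hone h; omega).1
    obtain ⟨x, y, hxy, hy, hyx⟩ := Pretzel.exists_triple hsort (by omega) (by omega) (by omega)
      (by omega) (by omega)
    rw [hxy] at hw h₁ h₂ ⊢
    refine ⟨x, y, h₁, h₂, hy, hyx, ?_, ?_, hw.unique (Pretzel.lowDeg_neg_triple hy hyx)⟩
    all_goals
      simp only [Pretzel.posSum, Pretzel.negSum, List.map_cons, List.map_nil, List.sum_cons,
        List.sum_nil]
      omega
  generalize hα : Pretzel.tally (· = 1) L = α at *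
  generalize hβ : Pretzel.tally (· = -1) L = β at *
  subst hV
  refine ⟨hV0, -v - w - n, by exact_mod_cast hspan, ?_, ?_⟩
  · intro hzpos
    have hc1 : ¬ Pretzel.IsOneNegOne a := fun h => by have := hone h; omega
    have := (hred'.resolve_left hc1).2 (by omega)
    have hv1 := g0 (by omega)
    have hw1 := g0' (by omega)
    clear g0 g0' g1 g1' g2 g2' hexc hone hred'
    omega
  intro hz00
  refine ⟨?_, ?_⟩
  · intro e1 e2
    refine ⟨fun hc1 => ?_, fun hc1 => ?_⟩
    -- As αβ = 0, S = Σ + max(0, 1 - (r + λ)) + max(0, 1 - (s - λ)). Both maxima are positive only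
    -- if r = s = λ = 0, which would make the tuple empty; so one of them is the stated minimum
    -- term. For P(1, -1) both equal 1.
    · have := (hred'.resolve_left hc1).1
      have hv1 := g1 hz00 (by omega)
      have hw1 := g1' hz00 (by omega)
      clear g0 g0' g1 g1' g2 g2' hexc hone hred'
      omega
    · have := hone hc1
      have hv1 := g1 hz00 (by omega)
      have hw1 := g1' hz00 (by omega)
      clear g0 g0' g1 g1' g2 g2' hexc hone hred'
      omega
  intro hrl
  have hc1 : ¬ Pretzel.IsOneNegOne a := fun h => by have := hone h; omega
  have hαβ := (hred'.resolve_left hc1).1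
  by_cases hr1 : 1 < r
  · refine ⟨fun _ => ⟨fun hne => ?_, fun he => ?_⟩, fun h => by omega, fun h => by omega,
      fun h => by omega, fun h => by omega⟩
    · have : ¬ (r = 2 ∧ lam = -1 ∧ s = 0) := fun ⟨e1, e2, e3⟩ => hne (by rw [e1, e2, e3])
      have hv2 := g2 hz00 hr1 (by omega) (by omega)
      have hw1 := g1' hz00 (by omega)
      clear g0 g0' g1 g1' g2 g2' hexc hone hred'
      omega
    · simp only [Prod.mk.injEq] at he
      obtain ⟨x, y, e1, e2, e3, e4, e5, e7, e6⟩ := hexc hrl hz00 hr1 he.1 he.2.1 he.2.2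
      have hv2 := g2 hz00 hr1 (by omega) (by omega)
      clear g0 g0' g1 g1' g2 g2' hexc
      obtain ⟨u1, u2, u3, u4⟩ := Pretzel.valOf_triple e3 e4
      generalize Pretzel.valOf 1 (y - 1) (x - 1) 0 0 = u at *
      clear hone hred' hv hw hspan hV0 hc1 hsort h₃ h₄ h₅ m1 m2 m3 m4 m5 m6
      refine ⟨fun _ _ => ?_, fun _ _ => ?_, fun _ _ => ?_, fun _ => ?_⟩
      · have := u2 (by omega) (by omega)
        omega
      · have := u3 (by omega) (by omega)
        omega
      · have := u4 (by omega) (by omega)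
        omega
      · have := u1 (by omega)
        omega
  refine ⟨fun h => absurd h hr1, ?_⟩
  -- Now r ≤ 1 and r + λ = 1, so αβ = 0 forces β = 0 and r + α = 1: exactly one entry is positive
  -- and the others are below -1.
  obtain ⟨A, B, hAB, hA, hB1, hB⟩ := Pretzel.exists_onePos hsort (by omega) (by omega) (by omega)
  have hα1 : 0 ≤ Pretzel.tally (1 < ·) (B.map fun c : ℕ => -((c : ℤ) + 1)) :=
    Pretzel.tally_nonneg _
  have hα2 : 0 ≤ Pretzel.tally (· = 1) (B.map fun c : ℕ => -((c : ℤ) + 1)) :=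
    Pretzel.tally_nonneg _
  have hrA : r = if 1 < (A : ℤ) then 1 else 0 := by
    rw [hAB, Pretzel.onePos, Pretzel.tally_cons] at hr hα
    split_ifs at hr hα ⊢ <;> omega
  have hsB : s = B.length := by
    rw [hAB, Pretzel.onePos, List.length_cons, List.length_map] at hlen'
    push_cast at hlen'
    omega
  obtain ⟨hP, hN⟩ := Pretzel.sum_onePos A hB1
  have hvA := Pretzel.lowDeg_onePos_valOf hA hB1 hB
  rw [← hAB] at hP hvA
  rw [← hAB] at hN
  have hvA := hv.unique hvA
  -- Here λ = 0, and the negated pair again has exactly one positive entry.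
  have hwA : r = 1 → s = 1 → w = -1 - A + Pretzel.valOf (B.getD 0 0 + 1) (A - 1) 0 0 0 := by
    intro e1 e2
    obtain ⟨c₁, rfl⟩ := List.length_eq_one_iff.1 (show B.length = 1 by omega)
    have hA2 : 2 ≤ A := by
      split_ifs at hrA <;> omega
    rw [hAB] at hw
    exact hw.unique (Pretzel.lowDeg_neg_pair hA2 (hB1 c₁ (by simp)))
  have hw1 : s + β ≠ 1 + α → w = -Pretzel.posSum L - max (s + β) (1 + α) := g1' hz00
  -- Here λ = 1: the negated tuple has two entries above 1 and one -1, so its second coefficients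
  -- decide.
  have hw2 : r = 0 → s = 2 → w = -1 := by
    intro e1 e2
    have := g2' hz00 (by omega) (by omega) (by omega)
    rw [hP, if_neg (by split_ifs at hrA <;> omega)] at this
    omega
  have hc := Pretzel.getD_cases hB1 hB (by rw [hN, neg_neg]) hsB rfl rfl rfl rfl
  rw [hAB] at h₁ h₂ h₃ h₄ h₅
  rw [Pretzel.getD_onePos hB1] at h₂ h₃ h₄ h₅
  have h₁ : a₁ = A := h₁
  generalize B.getD 0 0 = c₁ at *
  generalize B.getD 1 0 = c₂ at *
  generalize B.getD 2 0 = c₃ at *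
  generalize B.getD 3 0 = c₄ at *
  have hvA : v = -1 - Pretzel.negSum L + Pretzel.valOf A c₁ c₂ c₃ c₄ := by
    rw [hvA, hN]
    omega
  generalize Pretzel.negSum L = N at *
  generalize Pretzel.posSum L = P at *
  have b₂ : |a₂| = -a₂ := abs_of_nonpos (by split_ifs at h₂ <;> omega)
  have b₃ : |a₃| = -a₃ := abs_of_nonpos (by split_ifs at h₃ <;> omega)
  have b₄ : |a₄| = -a₄ := abs_of_nonpos (by split_ifs at h₄ <;> omega)
  rw [b₂, b₃, b₄]
  clear g0 g0' g1 g1' g2 g2' hexc hone hred' hAB hB1 hB hα1 hα2 b₂ b₃ b₄ hα hβ hc1 hspan hV0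
  clear hv hw m1 m2 m3 m4 m5 m6 hN
  by_cases hr1 : r = 1
  · have hA2 : 2 ≤ A := by split_ifs at hrA <;> omega
    clear hrA hw2
    rw [if_pos (by omega)] at hP
    refine ⟨fun _ hs1 => ?_, fun _ hs1 => ?_, fun h => by omega, fun h => by omega⟩
    · rcases hc with ⟨e0, rfl, rfl, rfl, rfl, hc⟩ | ⟨e0, e1, rfl, rfl, rfl, hc⟩ | hc | hc | hc
      · rw [Pretzel.valOf, if_pos rfl] at hvA
        have hw1 := hw1 (by omega)
        clear hwA h₂ h₃ h₄ h₅
        refine ⟨fun _ => by omega, fun h => by omega, fun h => by omega, fun h => by omega⟩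
      · rw [if_neg e1] at h₂
        have hw' := hwA hr1 e0
        have := Pretzel.span_of_pair (S := -v - w - n) hA2 e1 (by omega)
        rw [h₁, h₂]
        exact ⟨fun h => by omega, fun _ => this.1, fun _ => this.2.1, fun _ => this.2.2⟩
      · omega
      · omega
      · omega
    · have hw1 := hw1 (by omega)
      clear hwA h₅
      have hc12 : c₁ ≠ 0 ∧ c₂ ≠ 0 ∧ c₁ ≤ c₂ := by omega
      rw [if_neg hc12.1] at h₂
      rw [if_neg hc12.2.1] at h₃
      refine Pretzel.span_of_one_lt (c₁ := c₁) (c₂ := c₂) (c₃ := c₃) (c₄ := c₄) ?_ hA2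
        hc12 ?_ h₁ h₂ h₃
      · clear hc h₂ h₃ h₄
        omega
      · by_cases h3 : c₃ = 0
        · rw [if_pos h3] at h₄
          omega
        · rw [if_neg h3] at h₄
          omega
  · have hA1 : A = 1 := by split_ifs at hrA <;> omega
    have hr0 : r = 0 := by split_ifs at hrA <;> omega
    clear hrA hwA
    subst hA1
    rw [if_neg (by omega)] at hP
    have hSg : Sg = N := by omega
    have key := Pretzel.span_of_eq_one (s := s) (Sg := Sg) (S := -v - w - n) ?_
      (by rw [hSg]; exact hc) h₂ h₃ h₄ h₅
    · exact ⟨fun h => by omega, fun h => by omega, fun _ => key.1, fun _ => key.2⟩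
    · clear h₂ h₃ h₄ h₅ hc
      -- Here n = s + 1, and w = -max(s, 2) except for s = 2, where the cancellation raises w from
      -- -2 to -1.
      by_cases hs2 : s = 2
      · have := hw2 hr0 hs2
        rw [if_pos hs2]
        omega
      · have := hw1 (by omega)
        rw [if_neg hs2]
        omega
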